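/- Let $\Bbbk$ be a commutative ring of characteristic not equal to two and let $z \in \Bbbk$. A supercategory is a category enriched in $\Bbbk$-supermodules, and in a strict monoidal supercategory the super interchange law $(f' \otimes g) \circ (f \otimes g') = (-1)^{\bar f \bar g} (f' \circ f) \otimes (g \circ g')$ holds for homogeneous $f, g$. A monoidal superfunctor is $\Bbbk$-linear and parity-preserving on morphism spaces. Let $\mathcal{Q}(z)$ be the strict monoidal supercategory generated by objects $\uparrow$, $\downarrow$, even morphisms $\sigma, \sigma' \colon \uparrow\otimes\uparrow \to \uparrow\otimes\uparrow$ (the positive and the negative crossing), $\rho \colon \uparrow\otimes\downarrow \to \downarrow\otimes\uparrow$, $c \colon \downarrow\otimes\uparrow \to \mathbf 1$ (left cap), $d \colon \mathbf 1 \to \uparrow\otimes\downarrow$ (left cup), and an odd morphism $\tau \colon \uparrow \to \uparrow$, subject to the following relations, where $\lambda := (c \otimes 1_{\uparrow} \otimes 1_{\downarrow}) \circ (1_{\downarrow} \otimes \sigma \otimes 1_{\downarrow}) \circ (1_{\downarrow} \otimes 1_{\uparrow} \otimes d)$ and $c' := c \circ \rho \colon \uparrow\otimes\downarrow \to \mathbf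 1$: $$\sigma' \sigma = 1 = \sigma \sigma', \quad \lambda \rho = 1_{\uparrow\otimes\downarrow}, \quad \rho\lambda = 1_{\downarrow\otimes\uparrow}, \quad (\sigma \otimes 1_\uparrow)(1_\uparrow \otimes \sigma)(\sigma \otimes 1_\uparrow) = (1_\uparrow \otimes \sigma)(\sigma \otimes 1_\uparrow)(1_\uparrow \otimes \sigma),$$ $$\sigma - \sigma' = z\, 1_{\uparrow\otimes\uparrow}, \quad \tau^2 = -1_\uparrow, \quad \sigma \circ (\tau \otimes 1_\uparrow) = (1_\uparrow \otimes \tau) \circ \sigma, \quad c' \circ (\tau \otimes 1_\downarrow) \circ d = 0 = c' \circ d,$$ $$(1_\uparrow \otimes c) \circ (d \otimes 1_\uparrow) = 1_\uparrow, \quad (c \otimes 1_\downarrow) \circ (1_\downarrow \otimes d) = 1_\downarrow .$$ Let $\mathcal{AQ}(z)$ be the strict monoidal supercategory obtained from $\mathcal{Q}(z)$ by adjoining an odd morphism $\omega \colon \uparrow \to \uparrow$ subject to the additional relations $$\omega^2 = -1_\uparrow, \quad \sigma \circ (1_\uparrow \otimes \omega) = (\omega \otimes 1_\uparrow) \circ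 \sigma, \quad c' \circ (\omega \otimes 1_\downarrow) \circ d = 0 .$$ Then the strict monoidal superfunctor $\mathcal{Q}(z) \to \mathcal{AQ}(z)$ that is the identity on objects and sends each generating morphism of $\mathcal{Q}(z)$ to the morphism of $\mathcal{AQ}(z)$ with the same name is faithful. -/

import Mathlib

open CategoryTheory

universe u v w v' w'

/-! ### Supercategories and strict monoidal supercategories -/

/-- A `k`-linear supercategory: every morphism space is a superspace `Hom = Hom₀ ⊕ Hom₁`,
identities are even and composition respects parities. -/
class Supercategory (k : Type u) [CommRing k] (C : Type v) [Category.{w} C] [Preadditive C]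
    [Linear k C] where
  /-- `part i X Y` is the space of morphisms `X ⟶ Y` of parity `i`. -/
  part : ZMod 2 → ∀ X Y : C, Submodule k (X ⟶ Y)
  isCompl : ∀ X Y : C, IsCompl (part 0 X Y) (part 1 X Y)
  id_mem : ∀ X : C, 𝟙 X ∈ part 0 X X
  comp_mem : ∀ {X Y Z : C} {i j : ZMod 2} {f : X ⟶ Y} {g : Y ⟶ Z},
    f ∈ part i X Y → g ∈ part j Y Z → f ≫ g ∈ part (i + j) X Z

/-- The sign `(-1) ^ (i * j)`. -/
def superSign (k : Type u) [CommRing k] (i j : ZMod 2) : k := (-1) ^ (i.val * j.val)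

/-- A strict monoidal supercategory.  The equalities of objects expressing strictness enter the
corresponding equalities of morphisms through `eqToHom`. -/
class StrictMonoidalSupercategory (k : Type u) [CommRing k] (C : Type v) [Category.{w} C]
    [Preadditive C] [Linear k C] [Supercategory k C] where
  unit : C
  tensorObj : C → C → C
  tensorHom : ∀ {X X' Y Y' : C}, (X ⟶ X') → (Y ⟶ Y') → (tensorObj X Y ⟶ tensorObj X' Y')
  add_tensor : ∀ {X X' Y Y' : C} (f f' : X ⟶ X') (g : Y ⟶ Y'),
    tensorHom (f + f') g = tensorHom f g + tensorHom f' g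
  tensor_add : ∀ {X X' Y Y' : C} (f : X ⟶ X') (g g' : Y ⟶ Y'),
    tensorHom f (g + g') = tensorHom f g + tensorHom f g'
  smul_tensor : ∀ {X X' Y Y' : C} (a : k) (f : X ⟶ X') (g : Y ⟶ Y'),
    tensorHom (a • f) g = a • tensorHom f g
  tensor_smul : ∀ {X X' Y Y' : C} (a : k) (f : X ⟶ X') (g : Y ⟶ Y'),
    tensorHom f (a • g) = a • tensorHom f g
  tensor_mem : ∀ {X X' Y Y' : C} {i j : ZMod 2} {f : X ⟶ X'} {g : Y ⟶ Y'},
    f ∈ Supercategory.part (k := k) i X X' → g ∈ Supercategory.part (k := k) j Y Y' →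
    tensorHom f g ∈ Supercategory.part (k := k) (i + j) (tensorObj X Y) (tensorObj X' Y')
  tensor_id : ∀ X Y : C, tensorHom (𝟙 X) (𝟙 Y) = 𝟙 (tensorObj X Y)
  /-- The super interchange law `(f' ⊗ g) ∘ (f ⊗ g') = (-1)^{|f||g|} (f' ∘ f) ⊗ (g ∘ g')`. -/
  interchange : ∀ {X X' X'' Y Y' Y'' : C} {i j : ZMod 2} (f : X ⟶ X') (f' : X' ⟶ X'')
    (g' : Y ⟶ Y') (g : Y' ⟶ Y''),
    f ∈ Supercategory.part (k := k) i X X' → g ∈ Supercategory.part (k := k) j Y' Y'' →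
    tensorHom f g' ≫ tensorHom f' g = superSign k i j • tensorHom (f ≫ f') (g' ≫ g)
  unit_tensorObj : ∀ X : C, tensorObj unit X = X
  tensorObj_unit : ∀ X : C, tensorObj X unit = X
  tensorObj_assoc : ∀ X Y Z : C,
    tensorObj (tensorObj X Y) Z = tensorObj X (tensorObj Y Z)
  unit_tensorHom : ∀ {X Y : C} (f : X ⟶ Y), tensorHom (𝟙 unit) f =
    eqToHom (unit_tensorObj X) ≫ f ≫ eqToHom (unit_tensorObj Y).symm
  tensorHom_unit : ∀ {X Y : C} (f : X ⟶ Y), tensorHom f (𝟙 unit) =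
    eqToHom (tensorObj_unit X) ≫ f ≫ eqToHom (tensorObj_unit Y).symm
  tensorHom_assoc : ∀ {X X' Y Y' Z Z' : C} (f : X ⟶ X') (g : Y ⟶ Y') (h : Z ⟶ Z'),
    tensorHom (tensorHom f g) h = eqToHom (tensorObj_assoc X Y Z) ≫
      tensorHom f (tensorHom g h) ≫ eqToHom (tensorObj_assoc X' Y' Z').symm

/-- A strict monoidal superfunctor between strict monoidal supercategories. -/
structure StrictMonoidalSuperfunctor (k : Type u) [CommRing k]
    (C : Type v) [Category.{w} C] [Preadditive C] [Linear k C] [Supercategory k C]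
    [StrictMonoidalSupercategory k C]
    (D : Type v') [Category.{w'} D] [Preadditive D] [Linear k D] [Supercategory k D]
    [StrictMonoidalSupercategory k D] extends C ⥤ D where
  map_add : ∀ {X Y : C} (f g : X ⟶ Y), map (f + g) = map f + map g
  map_smul : ∀ {X Y : C} (a : k) (f : X ⟶ Y), map (a • f) = a • map f
  map_mem : ∀ {X Y : C} {i : ZMod 2} {f : X ⟶ Y}, f ∈ Supercategory.part (k := k) i X Y →
    map f ∈ Supercategory.part (k := k) i (obj X) (obj Y)
  obj_unit : obj (StrictMonoidalSupercategory.unit k) = StrictMonoidalSupercategory.unit k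
  obj_tensor : ∀ X Y : C, obj (StrictMonoidalSupercategory.tensorObj k X Y) =
    StrictMonoidalSupercategory.tensorObj k (obj X) (obj Y)
  map_tensor : ∀ {X X' Y Y' : C} (f : X ⟶ X') (g : Y ⟶ Y'),
    map (StrictMonoidalSupercategory.tensorHom (k := k) f g) = eqToHom (obj_tensor X Y) ≫
      StrictMonoidalSupercategory.tensorHom (k := k) (map f) (map g) ≫
        eqToHom (obj_tensor X' Y').symm

/-! ### String diagrams over a set of generators -/

/-- Generating morphisms between words in the generating objects `Ob`, with parities. -/
structure Signature (Ob : Type) where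
  Gen : Type
  dom : Gen → List Ob
  cod : Gen → List Ob
  par : Gen → ZMod 2

/-- A horizontal layer `1_left ⊗ gen ⊗ 1_right` of a string diagram. -/
structure Layer {Ob : Type} (S : Signature Ob) (X Y : List Ob) where
  left : List Ob
  gen : S.Gen
  right : List Ob
  dom_eq : left ++ S.dom gen ++ right = X
  cod_eq : left ++ S.cod gen ++ right = Y

/-- String diagrams from `X` (bottom) to `Y` (top): finite vertical stacks of layers. -/
inductive Diagram {Ob : Type} (S : Signature Ob) (X : List Ob) : List Ob → Type
  | id : Diagram S X X
  | snoc {Y Z : List Ob} (d : Diagram S X Y) (l : Layer S Y Z) : Diagram S X Z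

/-- A map of generators that respects sources, targets and parities. -/
structure SigHom {Ob : Type} (S T : Signature Ob) where
  toFun : S.Gen → T.Gen
  dom_eq : ∀ g, T.dom (toFun g) = S.dom g
  cod_eq : ∀ g, T.cod (toFun g) = S.cod g
  par_eq : ∀ g, T.par (toFun g) = S.par g

namespace Layer

variable {Ob : Type} {S T : Signature Ob} {X Y : List Ob}

/-- Place identity strands to the left of a layer. -/
def whiskerL (A : List Ob) (l : Layer S X Y) : Layer S (A ++ X) (A ++ Y) where
  left := A ++ l.left
  gen := l.gen
  right := l.right
  dom_eq := by simpa using l.dom_eq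
  cod_eq := by simpa using l.cod_eq

/-- Place identity strands to the right of a layer. -/
def whiskerR (l : Layer S X Y) (B : List Ob) : Layer S (X ++ B) (Y ++ B) where
  left := l.left
  gen := l.gen
  right := l.right ++ B
  dom_eq := by simpa using congrArg (· ++ B) l.dom_eq
  cod_eq := by simpa using congrArg (· ++ B) l.cod_eq

/-- Replace the generator of a layer by its image. -/
def map (φ : SigHom S T) (l : Layer S X Y) : Layer T X Y where
  left := l.left
  gen := φ.toFun l.gen
  right := l.right
  dom_eq := by rw [φ.dom_eq, l.dom_eq]
  cod_eq := by rw [φ.cod_eq, l.cod_eq]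

end Layer

namespace Diagram

variable {Ob : Type} {S T : Signature Ob}

/-- The string diagram consisting of one generator. -/
def gen (g : S.Gen) : Diagram S (S.dom g) (S.cod g) :=
  snoc id ⟨[], g, [], by simp, by simp⟩

/-- Vertical stacking: `d.comp e` has `d` below `e`, so it represents `e ∘ d`. -/
def comp {X Y : List Ob} (d : Diagram S X Y) : ∀ {Z : List Ob}, Diagram S Y Z → Diagram S X Z
  | _, id => d
  | _, snoc e l => snoc (d.comp e) l

/-- `d.whiskerL A` is the diagram `1_A ⊗ d`. -/
def whiskerL (A : List Ob) {X : List Ob} : ∀ {Y : List Ob}, Diagram S X Y → Diagram S (A ++ X) (A ++ Y)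
  | _, id => id
  | _, snoc d l => snoc (whiskerL A d) (l.whiskerL A)

/-- `d.whiskerR B` is the diagram `d ⊗ 1_B`. -/
def whiskerR {X : List Ob} : ∀ {Y : List Ob}, Diagram S X Y → ∀ B : List Ob, Diagram S (X ++ B) (Y ++ B)
  | _, id, _ => id
  | _, snoc d l, B => snoc (whiskerR d B) (l.whiskerR B)

/-- The parity of a string diagram. -/
def parity {X : List Ob} : ∀ {Y : List Ob}, Diagram S X Y → ZMod 2
  | _, id => 0
  | _, snoc d l => parity d + S.par l.gen

/-- Replace every generator by its image. -/
def map (φ : SigHom S T) {X : List Ob} : ∀ {Y : List Ob}, Diagram S X Y → Diagram T X Y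
  | _, id => id
  | _, snoc d l => snoc (map φ d) (l.map φ)

/-- The identity diagram, between equal words. -/
def ofEq {X Y : List Ob} (h : X = Y) : Diagram S X Y := h ▸ id

variable {X Y Z W : List Ob}

theorem comp_assoc (d : Diagram S X Y) (e : Diagram S Y Z) (f : Diagram S Z W) :
    (d.comp e).comp f = d.comp (e.comp f) := by
  induction f with
  | id => rfl
  | snoc f l ih => simp [comp, ih]

theorem id_comp (d : Diagram S X Y) : (id : Diagram S X X).comp d = d := by
  induction d with
  | id => rfl
  | snoc f l ih => simp [comp, ih]

theorem whiskerL_comp (A : List Ob) (d : Diagram S X Y) (e : Diagram S Y Z) :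
    (d.comp e).whiskerL A = (d.whiskerL A).comp (e.whiskerL A) := by
  induction e with
  | id => rfl
  | snoc f l ih => simp [comp, whiskerL, ih]

theorem whiskerR_comp (B : List Ob) (d : Diagram S X Y) (e : Diagram S Y Z) :
    (d.comp e).whiskerR B = (d.whiskerR B).comp (e.whiskerR B) := by
  induction e with
  | id => rfl
  | snoc f l ih => simp [comp, whiskerR, ih]

theorem map_comp (φ : SigHom S T) (d : Diagram S X Y) (e : Diagram S Y Z) :
    (d.comp e).map φ = (d.map φ).comp (e.map φ) := by
  induction e with
  | id => rfl
  | snoc f l ih => simp [comp, map, ih]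

theorem map_whiskerL (φ : SigHom S T) (A : List Ob) (d : Diagram S X Y) :
    (d.whiskerL A).map φ = (d.map φ).whiskerL A := by
  induction d with
  | id => rfl
  | snoc f l ih => simp only [whiskerL, map, ih]; rfl

theorem map_whiskerR (φ : SigHom S T) (B : List Ob) (d : Diagram S X Y) :
    (d.whiskerR B).map φ = (d.map φ).whiskerR B := by
  induction d with
  | id => rfl
  | snoc f l ih => simp only [whiskerR, map, ih]; rfl

theorem parity_comp (d : Diagram S X Y) (e : Diagram S Y Z) :
    (d.comp e).parity = d.parity + e.parity := by
  induction e with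
  | id => simp [comp, parity]
  | snoc f l ih => simp [comp, parity, ih, add_assoc]

theorem parity_gen (g : S.Gen) : (gen g).parity = S.par g := zero_add _

theorem parity_whiskerL (A : List Ob) (d : Diagram S X Y) : (d.whiskerL A).parity = d.parity := by
  induction d with
  | id => rfl
  | snoc f l ih => simp only [whiskerL, parity, ih]; rfl

theorem parity_whiskerR (B : List Ob) (d : Diagram S X Y) : (d.whiskerR B).parity = d.parity := by
  induction d with
  | id => rfl
  | snoc f l ih => simp only [whiskerR, parity, ih]; rfl

theorem parity_map (φ : SigHom S T) (d : Diagram S X Y) : (d.map φ).parity = d.parity := by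
  induction d with
  | id => rfl
  | snoc f l ih => simp only [map, parity, ih]; congr 1; exact φ.par_eq _

/-- Two diagrams are equal up to an equality of their sources and of their targets. -/
def CastEq {X Y X' Y' : List Ob} (d : Diagram S X Y) (d' : Diagram S X' Y') : Prop :=
  ∃ (hX : X = X') (hY : Y = Y'), d = (ofEq hX).comp (d'.comp (ofEq hY.symm))

theorem castEq_id {X X' : List Ob} (h : X = X') : CastEq (id : Diagram S X X) (id : Diagram S X' X') := by
  subst h; exact ⟨rfl, rfl, rfl⟩

theorem castEq_snoc {X Y Z X' Y' Z' : List Ob} {d : Diagram S X Y} {d' : Diagram S X' Y'}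
    {l : Layer S Y Z} {l' : Layer S Y' Z'} (h : CastEq d d') (hZ : Z = Z')
    (h₁ : l.left = l'.left) (h₂ : l.gen = l'.gen) (h₃ : l.right = l'.right) :
    CastEq (d.snoc l) (d'.snoc l') := by
  obtain ⟨hX, hY, h⟩ := h
  subst hX hY hZ
  obtain ⟨a, g, b, _, _⟩ := l
  obtain ⟨a', g', b', _, _⟩ := l'
  obtain rfl : a = a' := h₁
  obtain rfl : g = g' := h₂
  obtain rfl : b = b' := h₃
  refine ⟨rfl, rfl, ?_⟩
  have h' : d = d' := by rw [h]; exact id_comp _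
  rw [h']
  exact (id_comp _).symm

theorem whiskerL_nil (d : Diagram S X Y) : d.whiskerL [] = d := by
  induction d with
  | id => rfl
  | snoc f l ih => simp only [whiskerL, ih]; rfl

theorem whiskerR_nil (d : Diagram S X Y) : CastEq (d.whiskerR []) d := by
  induction d with
  | id => exact castEq_id (by simp)
  | snoc f l ih => exact castEq_snoc ih (by simp) rfl rfl (by simp [Layer.whiskerR])

theorem whiskerL_append (A B : List Ob) (d : Diagram S X Y) :
    CastEq (d.whiskerL (A ++ B)) ((d.whiskerL B).whiskerL A) := by
  induction d with
  | id => exact castEq_id (by simp)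
  | snoc f l ih => exact castEq_snoc ih (by simp) (by simp [Layer.whiskerL]) rfl rfl

theorem whiskerR_append (A B : List Ob) (d : Diagram S X Y) :
    CastEq ((d.whiskerR A).whiskerR B) (d.whiskerR (A ++ B)) := by
  induction d with
  | id => exact castEq_id (by simp)
  | snoc f l ih => exact castEq_snoc ih (by simp) rfl rfl (by simp [Layer.whiskerR])

theorem whiskerL_whiskerR (A B : List Ob) (d : Diagram S X Y) :
    CastEq ((d.whiskerL A).whiskerR B) ((d.whiskerR B).whiskerL A) := by
  induction d with
  | id => exact castEq_id (by simp)
  | snoc f l ih => exact castEq_snoc ih (by simp) rfl rfl rfl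

end Diagram

/-! ### Linear combinations of string diagrams and presented supercategories -/

/-- Formal `k`-linear combinations of string diagrams. -/
abbrev Chain {Ob : Type} (k : Type u) [CommRing k] (S : Signature Ob) (X Y : List Ob) : Type u :=
  Diagram S X Y →₀ k

namespace Chain

variable {Ob : Type} {k : Type u} [CommRing k] {S T : Signature Ob} {X Y Z W : List Ob}

/-- A string diagram as a linear combination. -/
noncomputable def of (k : Type u) [CommRing k] (d : Diagram S X Y) : Chain k S X Y :=
  Finsupp.single d 1

/-- Bilinear extension of vertical stacking. -/
noncomputable def comp : Chain k S X Y →ₗ[k] Chain k S Y Z →ₗ[k] Chain k S X Z :=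
  Finsupp.linearCombination k fun d => Finsupp.lmapDomain k k fun e => d.comp e

/-- Linear extension of `d ↦ 1_A ⊗ d`. -/
noncomputable def whiskerL (A : List Ob) : Chain k S X Y →ₗ[k] Chain k S (A ++ X) (A ++ Y) :=
  Finsupp.lmapDomain k k fun d => d.whiskerL A

/-- Linear extension of `d ↦ d ⊗ 1_B`. -/
noncomputable def whiskerR (B : List Ob) : Chain k S X Y →ₗ[k] Chain k S (X ++ B) (Y ++ B) :=
  Finsupp.lmapDomain k k fun d => d.whiskerR B

/-- Linear extension of a map of generators. -/
noncomputable def map (φ : SigHom S T) : Chain k S X Y →ₗ[k] Chain k T X Y :=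
  Finsupp.lmapDomain k k fun d => d.map φ

/-- Linear combinations of string diagrams of parity `i`. -/
noncomputable def part (k : Type u) [CommRing k] (S : Signature Ob) (i : ZMod 2) (X Y : List Ob) :
    Submodule k (Chain k S X Y) :=
  Submodule.span k {f | ∃ d : Diagram S X Y, d.parity = i ∧ f = of k d}

@[simp] theorem comp_of (d : Diagram S X Y) (e : Diagram S Y Z) :
    comp (of k d) (of k e) = of k (d.comp e) := by
  simp [comp, of]

@[simp] theorem whiskerL_of (A : List Ob) (d : Diagram S X Y) :
    whiskerL A (of k d) = of k (d.whiskerL A) := by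
  simp [whiskerL, of]

@[simp] theorem whiskerR_of (B : List Ob) (d : Diagram S X Y) :
    whiskerR B (of k d) = of k (d.whiskerR B) := by
  simp [whiskerR, of]

@[simp] theorem map_of (φ : SigHom S T) (d : Diagram S X Y) :
    map φ (of k d) = of k (d.map φ) := by
  simp [map, of]

theorem induction {P : Chain k S X Y → Prop} (f : Chain k S X Y) (hz : P 0)
    (ha : ∀ f g, P f → P g → P (f + g)) (hs : ∀ (a : k) f, P f → P (a • f))
    (ho : ∀ d, P (of k d)) : P f := by
  induction f using Finsupp.induction_linear with
  | zero => exact hz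
  | add f g hf hg => exact ha f g hf hg
  | single d a =>
    have h := hs a _ (ho d)
    rwa [of, Finsupp.smul_single, smul_eq_mul, mul_one] at h

theorem comp_assoc (f : Chain k S X Y) (g : Chain k S Y Z) (h : Chain k S Z W) :
    comp (comp f g) h = comp f (comp g h) := by
  induction f using Chain.induction with
  | hz => simp
  | ha f f' hf hf' => simp [hf, hf']
  | hs a f hf => simp [hf]
  | ho d =>
    induction g using Chain.induction with
    | hz => simp
    | ha f f' hf hf' => simp [hf, hf']
    | hs a f hf => simp [hf]
    | ho e =>
      induction h using Chain.induction with
      | hz => simp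
      | ha f f' hf hf' => simp only [map_add, hf, hf']
      | hs a f hf => simp only [map_smul, hf]
      | ho f => simp [Diagram.comp_assoc]

theorem id_comp (f : Chain k S X Y) : comp (of k Diagram.id) f = f := by
  induction f using Chain.induction with
  | hz => simp
  | ha f f' hf hf' => simp only [map_add, hf, hf']
  | hs a f hf => simp only [map_smul, hf]
  | ho d => simp [Diagram.id_comp]

theorem comp_id (f : Chain k S X Y) : comp f (of k Diagram.id) = f := by
  induction f using Chain.induction with
  | hz => simp
  | ha f f' hf hf' => simp [hf, hf']
  | hs a f hf => simp [hf]
  | ho d => simp [Diagram.comp]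

theorem whiskerL_comp (A : List Ob) (f : Chain k S X Y) (g : Chain k S Y Z) :
    whiskerL A (comp f g) = comp (whiskerL A f) (whiskerL A g) := by
  induction f using Chain.induction with
  | hz => simp
  | ha f f' hf hf' => simp [hf, hf']
  | hs a f hf => simp [hf]
  | ho d =>
    induction g using Chain.induction with
    | hz => simp
    | ha f f' hf hf' => simp only [map_add, hf, hf']
    | hs a f hf => simp only [map_smul, hf]
    | ho e => simp [Diagram.whiskerL_comp]

theorem whiskerR_comp (B : List Ob) (f : Chain k S X Y) (g : Chain k S Y Z) :
    whiskerR B (comp f g) = comp (whiskerR B f) (whiskerR B g) := by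
  induction f using Chain.induction with
  | hz => simp
  | ha f f' hf hf' => simp [hf, hf']
  | hs a f hf => simp [hf]
  | ho d =>
    induction g using Chain.induction with
    | hz => simp
    | ha f f' hf hf' => simp only [map_add, hf, hf']
    | hs a f hf => simp only [map_smul, hf]
    | ho e => simp [Diagram.whiskerR_comp]

theorem map_comp (φ : SigHom S T) (f : Chain k S X Y) (g : Chain k S Y Z) :
    map φ (comp f g) = comp (map φ f) (map φ g) := by
  induction f using Chain.induction with
  | hz => simp
  | ha f f' hf hf' => simp [hf, hf']
  | hs a f hf => simp [hf]
  | ho d =>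
    induction g using Chain.induction with
    | hz => simp
    | ha f f' hf hf' => simp only [map_add, hf, hf']
    | hs a f hf => simp only [map_smul, hf]
    | ho e => simp [Diagram.map_comp]

theorem map_whiskerL (φ : SigHom S T) (A : List Ob) (f : Chain k S X Y) :
    map φ (whiskerL A f) = whiskerL A (map φ f) := by
  induction f using Chain.induction with
  | hz => simp
  | ha f f' hf hf' => simp only [map_add, hf, hf']
  | hs a f hf => simp only [map_smul, hf]
  | ho d => simp [Diagram.map_whiskerL]

theorem map_whiskerR (φ : SigHom S T) (B : List Ob) (f : Chain k S X Y) :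
    map φ (whiskerR B f) = whiskerR B (map φ f) := by
  induction f using Chain.induction with
  | hz => simp
  | ha f f' hf hf' => simp only [map_add, hf, hf']
  | hs a f hf => simp only [map_smul, hf]
  | ho d => simp [Diagram.map_whiskerR]

theorem of_mem_part (d : Diagram S X Y) : of k d ∈ part k S d.parity X Y :=
  Submodule.subset_span ⟨d, rfl, rfl⟩

theorem map_mem_part (φ : SigHom S T) {i : ZMod 2} {f : Chain k S X Y} (hf : f ∈ part k S i X Y) :
    map φ f ∈ part k T i X Y := by
  induction hf using Submodule.span_induction with
  | mem f h =>
    obtain ⟨d, rfl, rfl⟩ := h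
    rw [map_of, ← Diagram.parity_map φ d]
    exact of_mem_part _
  | zero => simp
  | add f g _ _ hf hg => rw [map_add]; exact add_mem hf hg
  | smul a f _ hf => rw [map_smul]; exact Submodule.smul_mem _ _ hf

/-- The component of parity `i`. -/
noncomputable def proj (i : ZMod 2) : Chain k S X Y →ₗ[k] Chain k S X Y :=
  Finsupp.linearCombination k fun d => if d.parity = i then of k d else 0

@[simp] theorem proj_of (i : ZMod 2) (d : Diagram S X Y) :
    proj i (of k d) = if d.parity = i then of k d else 0 := by
  simp [proj, of]

theorem proj_part {i j : ZMod 2} {f : Chain k S X Y} (hf : f ∈ part k S j X Y) :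
    proj i f = if j = i then f else 0 := by
  induction hf using Submodule.span_induction with
  | mem f h => obtain ⟨d, rfl, rfl⟩ := h; simp
  | zero => simp
  | add f g _ _ hf hg => rw [map_add, hf, hg]; split_ifs <;> simp
  | smul a f _ hf => rw [map_smul, hf]; split_ifs <;> simp

theorem proj_of_comp (i : ZMod 2) (d : Diagram S X Y) (f : Chain k S Y Z) :
    proj i (comp (of k d) f) = comp (of k d) (proj (i - d.parity) f) := by
  induction f using Chain.induction with
  | hz => simp
  | ha f f' hf hf' => simp only [map_add, hf, hf']
  | hs a f hf => simp only [map_smul, hf]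
  | ho e =>
    simp only [comp_of, proj_of, Diagram.parity_comp, eq_sub_iff_add_eq, add_comm e.parity]
    split_ifs <;> simp

theorem proj_comp_of (i : ZMod 2) (f : Chain k S X Y) (e : Diagram S Y Z) :
    proj i (comp f (of k e)) = comp (proj (i - e.parity) f) (of k e) := by
  induction f using Chain.induction with
  | hz => simp
  | ha f f' hf hf' => simp only [map_add, LinearMap.add_apply, hf, hf']
  | hs a f hf => simp only [map_smul, LinearMap.smul_apply, hf]
  | ho d =>
    simp only [comp_of, proj_of, Diagram.parity_comp, eq_sub_iff_add_eq]
    split_ifs <;> simp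

theorem proj_whiskerL (i : ZMod 2) (A : List Ob) (f : Chain k S X Y) :
    proj i (whiskerL A f) = whiskerL A (proj i f) := by
  induction f using Chain.induction with
  | hz => simp
  | ha f f' hf hf' => simp only [map_add, hf, hf']
  | hs a f hf => simp only [map_smul, hf]
  | ho e =>
    rw [whiskerL_of, proj_of, proj_of, Diagram.parity_whiskerL]
    split_ifs <;> simp

theorem proj_whiskerR (i : ZMod 2) (B : List Ob) (f : Chain k S X Y) :
    proj i (whiskerR B f) = whiskerR B (proj i f) := by
  induction f using Chain.induction with
  | hz => simp
  | ha f f' hf hf' => simp only [map_add, hf, hf']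
  | hs a f hf => simp only [map_smul, hf]
  | ho e =>
    rw [whiskerR_of, proj_of, proj_of, Diagram.parity_whiskerR]
    split_ifs <;> simp

end Chain

/-- Generators and relations for a strict monoidal `k`-linear supercategory.  A relation `f` means
that `f` is to become zero; every relation is homogeneous. -/
structure Presentation (k : Type u) [CommRing k] (Ob : Type) where
  sig : Signature Ob
  rel : ∀ X Y : List Ob, Chain k sig X Y → Prop
  homogeneous : ∀ X Y f, rel X Y f → ∃ i, f ∈ Chain.part k sig i X Y

namespace Presentation

variable {k : Type u} [CommRing k] {Ob : Type} (P : Presentation k Ob)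

/-- The two-sided tensor ideal generated by the defining relations and by the super interchange law
`(f ⊗ 1) ∘ (1 ⊗ g) = (-1)^{|f||g|} (1 ⊗ g) ∘ (f ⊗ 1)`. -/
inductive Ideal : ∀ X Y : List Ob, Chain k P.sig X Y → Prop
  | rel {X Y : List Ob} {f : Chain k P.sig X Y} (hf : P.rel X Y f) : Ideal X Y f
  | interchange {X X' Y Y' : List Ob} (f : Diagram P.sig X X') (g : Diagram P.sig Y Y') :
      Ideal (X ++ Y) (X' ++ Y')
        (Chain.of k ((g.whiskerL X).comp (f.whiskerR Y')) -
          superSign k f.parity g.parity • Chain.of k ((f.whiskerR Y).comp (g.whiskerL X')))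
  | zero (X Y : List Ob) : Ideal X Y 0
  | add {X Y : List Ob} {f g : Chain k P.sig X Y} (hf : Ideal X Y f) (hg : Ideal X Y g) :
      Ideal X Y (f + g)
  | smul {X Y : List Ob} (a : k) {f : Chain k P.sig X Y} (hf : Ideal X Y f) : Ideal X Y (a • f)
  | comp_left {X Y Z : List Ob} (d : Diagram P.sig X Y) {f : Chain k P.sig Y Z}
      (hf : Ideal Y Z f) : Ideal X Z (Chain.comp (Chain.of k d) f)
  | comp_right {X Y Z : List Ob} {f : Chain k P.sig X Y} (hf : Ideal X Y f)
      (e : Diagram P.sig Y Z) : Ideal X Z (Chain.comp f (Chain.of k e))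
  | whiskerL (A : List Ob) {X Y : List Ob} {f : Chain k P.sig X Y} (hf : Ideal X Y f) :
      Ideal (A ++ X) (A ++ Y) (Chain.whiskerL A f)
  | whiskerR {X Y : List Ob} {f : Chain k P.sig X Y} (hf : Ideal X Y f) (B : List Ob) :
      Ideal (X ++ B) (Y ++ B) (Chain.whiskerR B f)

/-- The ideal as a family of submodules. -/
noncomputable def ideal (X Y : List Ob) : Submodule k (Chain k P.sig X Y) where
  carrier := {f | P.Ideal X Y f}
  zero_mem' := .zero X Y
  add_mem' := .add
  smul_mem' := fun a _ hf => .smul a hf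

/-- The morphism space of the presented supercategory. -/
abbrev Hom (X Y : List Ob) : Type u := Chain k P.sig X Y ⧸ P.ideal X Y

variable {P} {X Y Z W : List Ob}

theorem ideal_comp_left (f : Chain k P.sig X Y) {g : Chain k P.sig Y Z} (hg : g ∈ P.ideal Y Z) :
    Chain.comp f g ∈ P.ideal X Z := by
  induction f using Chain.induction with
  | hz => simp
  | ha f f' hf hf' => simpa using add_mem hf hf'
  | hs a f hf => simpa using Submodule.smul_mem _ a hf
  | ho d => exact .comp_left d hg

theorem ideal_comp_right {f : Chain k P.sig X Y} (hf : f ∈ P.ideal X Y) (g : Chain k P.sig Y Z) :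
    Chain.comp f g ∈ P.ideal X Z := by
  induction g using Chain.induction with
  | hz => simp
  | ha f f' hf hf' => rw [map_add]; exact add_mem hf hf'
  | hs a f hf => rw [map_smul]; exact Submodule.smul_mem _ a hf
  | ho d => exact .comp_right hf d

theorem proj_mem_ideal (i : ZMod 2) {f : Chain k P.sig X Y} (hf : f ∈ P.ideal X Y) :
    Chain.proj i f ∈ P.ideal X Y := by
  induction hf generalizing i with
  | rel hf =>
    obtain ⟨j, hj⟩ := P.homogeneous _ _ _ hf
    rw [Chain.proj_part hj]
    split_ifs
    · exact .rel hf
    · exact .zero _ _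
  | @interchange X X' Y Y' f g =>
    have h : Chain.of k ((g.whiskerL X).comp (f.whiskerR Y')) -
          superSign k f.parity g.parity • Chain.of k ((f.whiskerR Y).comp (g.whiskerL X')) ∈
        Chain.part k P.sig (f.parity + g.parity) (X ++ Y) (X' ++ Y') := by
      refine sub_mem ?_ (Submodule.smul_mem _ _ ?_)
      · refine Submodule.subset_span ⟨_, ?_, rfl⟩
        rw [Diagram.parity_comp, Diagram.parity_whiskerL, Diagram.parity_whiskerR, add_comm]
      · refine Submodule.subset_span ⟨_, ?_, rfl⟩
        rw [Diagram.parity_comp, Diagram.parity_whiskerL, Diagram.parity_whiskerR]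
    rw [Chain.proj_part h]
    split_ifs
    · exact .interchange f g
    · exact .zero _ _
  | zero => rw [map_zero]; exact .zero _ _
  | add _ _ hf hg => rw [map_add]; exact add_mem (hf i) (hg i)
  | smul a _ hf => rw [map_smul]; exact Submodule.smul_mem _ a (hf i)
  | comp_left d _ hf => rw [Chain.proj_of_comp]; exact .comp_left d (hf _)
  | comp_right _ e hf => rw [Chain.proj_comp_of]; exact .comp_right (hf _) e
  | whiskerL A _ hf => rw [Chain.proj_whiskerL]; exact .whiskerL A (hf i)
  | whiskerR _ B hf => rw [Chain.proj_whiskerR]; exact .whiskerR (hf i) B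

namespace Hom

/-- The class of a linear combination of string diagrams. -/
noncomputable def mk (P : Presentation k Ob) : Chain k P.sig X Y →ₗ[k] P.Hom X Y := (P.ideal X Y).mkQ

/-- The morphism represented by a string diagram. -/
noncomputable def of (P : Presentation k Ob) (d : Diagram P.sig X Y) : P.Hom X Y :=
  mk P (Chain.of k d)

theorem mk_eq_zero {f : Chain k P.sig X Y} : mk P f = 0 ↔ P.Ideal X Y f :=
  Submodule.Quotient.mk_eq_zero _

theorem mk_surjective : Function.Surjective (mk P : Chain k P.sig X Y → P.Hom X Y) :=
  Submodule.mkQ_surjective _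

/-- Composition, in diagrammatic order. -/
noncomputable def comp : P.Hom X Y →ₗ[k] P.Hom Y Z →ₗ[k] P.Hom X Z :=
  (P.ideal X Y).liftQ
    (LinearMap.mk₂ k
      (fun f g => (P.ideal Y Z).mapQ (P.ideal X Z) (Chain.comp f)
        (fun _ hg => ideal_comp_left f hg) g)
      (fun f f' g => by obtain ⟨g, rfl⟩ := mk_surjective g; simp [mk])
      (fun a f g => by obtain ⟨g, rfl⟩ := mk_surjective g; simp [mk])
      (fun f g g' => map_add _ g g')
      (fun a f g => map_smul _ a g))
    (fun f hf => by
      rw [LinearMap.mem_ker]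
      refine LinearMap.ext fun g => ?_
      obtain ⟨g, rfl⟩ := mk_surjective g
      exact mk_eq_zero.2 (ideal_comp_right hf g))

/-- `1_A ⊗ f`. -/
noncomputable def whiskerL (A : List Ob) : P.Hom X Y →ₗ[k] P.Hom (A ++ X) (A ++ Y) :=
  (P.ideal X Y).mapQ (P.ideal _ _) (Chain.whiskerL A) fun _ hf => .whiskerL A hf

/-- `f ⊗ 1_B`. -/
noncomputable def whiskerR (B : List Ob) : P.Hom X Y →ₗ[k] P.Hom (X ++ B) (Y ++ B) :=
  (P.ideal X Y).mapQ (P.ideal _ _) (Chain.whiskerR B) fun _ hf => .whiskerR hf B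

/-- Morphisms of parity `i`. -/
noncomputable def part (P : Presentation k Ob) (i : ZMod 2) (X Y : List Ob) : Submodule k (P.Hom X Y) :=
  Submodule.span k {f | ∃ d : Diagram P.sig X Y, d.parity = i ∧ f = of P d}

theorem comp_mk (f : Chain k P.sig X Y) (g : Chain k P.sig Y Z) :
    comp (mk P f) (mk P g) = mk P (Chain.comp f g) := rfl

theorem whiskerL_mk (A : List Ob) (f : Chain k P.sig X Y) :
    whiskerL A (mk P f) = mk P (Chain.whiskerL A f) := rfl

theorem whiskerR_mk (B : List Ob) (f : Chain k P.sig X Y) :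
    whiskerR B (mk P f) = mk P (Chain.whiskerR B f) := rfl

theorem comp_of (d : Diagram P.sig X Y) (e : Diagram P.sig Y Z) :
    comp (of P d) (of P e) = of P (d.comp e) := by
  simp [of, comp_mk]

theorem whiskerL_of (A : List Ob) (d : Diagram P.sig X Y) :
    whiskerL A (of P d) = of P (d.whiskerL A) := by
  simp [of, whiskerL_mk]

theorem whiskerR_of (B : List Ob) (d : Diagram P.sig X Y) :
    whiskerR B (of P d) = of P (d.whiskerR B) := by
  simp [of, whiskerR_mk]

theorem comp_assoc (f : P.Hom X Y) (g : P.Hom Y Z) (h : P.Hom Z W) :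
    comp (comp f g) h = comp f (comp g h) := by
  obtain ⟨f, rfl⟩ := mk_surjective f
  obtain ⟨g, rfl⟩ := mk_surjective g
  obtain ⟨h, rfl⟩ := mk_surjective h
  simp only [comp_mk, Chain.comp_assoc]

theorem id_comp (f : P.Hom X Y) : comp (of P Diagram.id) f = f := by
  obtain ⟨f, rfl⟩ := mk_surjective f
  simp only [of, comp_mk, Chain.id_comp]

theorem comp_id (f : P.Hom X Y) : comp f (of P Diagram.id) = f := by
  obtain ⟨f, rfl⟩ := mk_surjective f
  simp only [of, comp_mk, Chain.comp_id]

theorem add_comp (f f' : P.Hom X Y) (g : P.Hom Y Z) :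
    comp (f + f') g = comp f g + comp f' g := by simp

theorem comp_add (f : P.Hom X Y) (g g' : P.Hom Y Z) :
    comp f (g + g') = comp f g + comp f g' := by simp

theorem smul_comp (a : k) (f : P.Hom X Y) (g : P.Hom Y Z) :
    comp (a • f) g = a • comp f g := by simp

theorem comp_smul (f : P.Hom X Y) (a : k) (g : P.Hom Y Z) :
    comp f (a • g) = a • comp f g := by simp

theorem whiskerL_comp (A : List Ob) (f : P.Hom X Y) (g : P.Hom Y Z) :
    whiskerL A (comp f g) = comp (whiskerL A f) (whiskerL A g) := by
  obtain ⟨f, rfl⟩ := mk_surjective f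
  obtain ⟨g, rfl⟩ := mk_surjective g
  simp only [comp_mk, whiskerL_mk, Chain.whiskerL_comp]

theorem whiskerR_comp (B : List Ob) (f : P.Hom X Y) (g : P.Hom Y Z) :
    whiskerR B (comp f g) = comp (whiskerR B f) (whiskerR B g) := by
  obtain ⟨f, rfl⟩ := mk_surjective f
  obtain ⟨g, rfl⟩ := mk_surjective g
  simp only [comp_mk, whiskerR_mk, Chain.whiskerR_comp]

theorem of_mem_part (d : Diagram P.sig X Y) : of P d ∈ part P d.parity X Y :=
  Submodule.subset_span ⟨d, rfl, rfl⟩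

theorem induction {Q : P.Hom X Y → Prop} (f : P.Hom X Y) (hz : Q 0)
    (ha : ∀ f g, Q f → Q g → Q (f + g)) (hs : ∀ (a : k) f, Q f → Q (a • f))
    (ho : ∀ d, Q (of P d)) : Q f := by
  obtain ⟨f, rfl⟩ := mk_surjective f
  induction f using Chain.induction with
  | hz => simpa using hz
  | ha f g hf hg => simpa using ha _ _ hf hg
  | hs a f hf => simpa using hs a _ hf
  | ho d => exact ho d

theorem isCompl_part (X Y : List Ob) : IsCompl (part P 0 X Y) (part P 1 X Y) := by
  let π : P.Hom X Y →ₗ[k] P.Hom X Y :=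
    (P.ideal X Y).mapQ (P.ideal X Y) (Chain.proj 0) fun _ hf => proj_mem_ideal 0 hf
  have hπ : ∀ d, π (of P d) = if d.parity = 0 then of P d else 0 := fun d => by
    change mk P (Chain.proj 0 (Chain.of k d)) = _
    rw [Chain.proj_of]
    split_ifs
    · rfl
    · exact map_zero _
  have h0 : ∀ f ∈ part P 0 X Y, π f = f := fun f hf => by
    induction hf using Submodule.span_induction with
    | mem f h => obtain ⟨d, hd, rfl⟩ := h; rw [hπ, if_pos hd]
    | zero => simp
    | add f g _ _ hf hg => rw [map_add, hf, hg]
    | smul a f _ hf => rw [map_smul, hf]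
  have h1 : ∀ f ∈ part P 1 X Y, π f = 0 := fun f hf => by
    induction hf using Submodule.span_induction with
    | mem f h => obtain ⟨d, hd, rfl⟩ := h; rw [hπ, if_neg (by rw [hd]; decide)]
    | zero => simp
    | add f g _ _ hf hg => rw [map_add, hf, hg, add_zero]
    | smul a f _ hf => rw [map_smul, hf, smul_zero]
  constructor
  · rw [Submodule.disjoint_def]
    intro f hf hf'
    rw [← h0 f hf, h1 f hf']
  · rw [codisjoint_iff, eq_top_iff]
    rintro f -
    induction f using Hom.induction with
    | hz => exact zero_mem _
    | ha f g hf hg => exact add_mem hf hg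
    | hs a f hf => exact Submodule.smul_mem _ _ hf
    | ho d =>
      have h : d.parity = 0 ∨ d.parity = 1 := by generalize d.parity = i; revert i; decide
      rcases h with h | h
      · exact Submodule.mem_sup_left (Submodule.subset_span ⟨d, h, rfl⟩)
      · exact Submodule.mem_sup_right (Submodule.subset_span ⟨d, h, rfl⟩)

theorem comp_mem_part {i j : ZMod 2} {f : P.Hom X Y} {g : P.Hom Y Z} (hf : f ∈ part P i X Y)
    (hg : g ∈ part P j Y Z) : comp f g ∈ part P (i + j) X Z := by
  induction hf using Submodule.span_induction with
  | zero => simp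
  | add f f' _ _ hf hf' => rw [map_add]; exact add_mem hf hf'
  | smul a f _ hf => rw [map_smul]; exact Submodule.smul_mem _ _ hf
  | mem f h =>
    obtain ⟨d, rfl, rfl⟩ := h
    induction hg using Submodule.span_induction with
    | zero => simp
    | add f f' _ _ hf hf' => rw [map_add]; exact add_mem hf hf'
    | smul a f _ hf => rw [map_smul]; exact Submodule.smul_mem _ _ hf
    | mem g h =>
      obtain ⟨e, rfl, rfl⟩ := h
      rw [comp_of, ← Diagram.parity_comp]
      exact of_mem_part _

theorem whiskerL_mem_part (A : List Ob) {i : ZMod 2} {f : P.Hom X Y} (hf : f ∈ part P i X Y) :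
    whiskerL A f ∈ part P i (A ++ X) (A ++ Y) := by
  induction hf using Submodule.span_induction with
  | zero => simp
  | add f f' _ _ hf hf' => rw [map_add]; exact add_mem hf hf'
  | smul a f _ hf => rw [map_smul]; exact Submodule.smul_mem _ _ hf
  | mem f h =>
    obtain ⟨d, rfl, rfl⟩ := h
    rw [whiskerL_of, ← Diagram.parity_whiskerL A d]
    exact of_mem_part _

theorem whiskerR_mem_part (B : List Ob) {i : ZMod 2} {f : P.Hom X Y} (hf : f ∈ part P i X Y) :
    whiskerR B f ∈ part P i (X ++ B) (Y ++ B) := by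
  induction hf using Submodule.span_induction with
  | zero => simp
  | add f f' _ _ hf hf' => rw [map_add]; exact add_mem hf hf'
  | smul a f _ hf => rw [map_smul]; exact Submodule.smul_mem _ _ hf
  | mem f h =>
    obtain ⟨d, rfl, rfl⟩ := h
    rw [whiskerR_of, ← Diagram.parity_whiskerR B d]
    exact of_mem_part _

theorem interchange {X' Y' : List Ob} {i j : ZMod 2} {f : P.Hom X X'} {g : P.Hom Y Y'}
    (hf : f ∈ part P i X X') (hg : g ∈ part P j Y Y') :
    comp (whiskerR Y f) (whiskerL X' g) =
      superSign k i j • comp (whiskerL X g) (whiskerR Y' f) := by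
  induction hf using Submodule.span_induction with
  | zero => simp
  | add f f' _ _ hf hf' => simp only [map_add, LinearMap.add_apply, hf, hf', smul_add]
  | smul a f _ hf => simp only [map_smul, LinearMap.smul_apply, hf, smul_comm _ a]
  | mem f h =>
    obtain ⟨d, rfl, rfl⟩ := h
    induction hg using Submodule.span_induction with
    | zero => simp
    | add f f' _ _ hf hf' => simp only [map_add, LinearMap.add_apply, hf, hf', smul_add]
    | smul a f _ hf => simp only [map_smul, LinearMap.smul_apply, hf, smul_comm _ a]
    | mem g h =>
      obtain ⟨e, rfl, rfl⟩ := h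
      have h := mk_eq_zero.2 (Ideal.interchange (P := P) d e)
      rw [map_sub, map_smul, sub_eq_zero] at h
      simp only [whiskerL_of, whiskerR_of, comp_of]
      rw [of, of, h, smul_smul, superSign, ← mul_pow]
      simp

end Hom

/-- The strict monoidal supercategory presented by `P`.  Its objects are the words in the
generating objects. -/
structure Cat (P : Presentation k Ob) where
  word : List Ob

namespace Cat

noncomputable instance : Category P.Cat where
  Hom X Y := P.Hom X.word Y.word
  id _ := Hom.of P Diagram.id
  comp f g := Hom.comp f g
  id_comp := Hom.id_comp
  comp_id := Hom.comp_id
  assoc := Hom.comp_assoc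

noncomputable instance : Preadditive P.Cat where
  homGroup X Y := inferInstanceAs (AddCommGroup (P.Hom X.word Y.word))
  add_comp _ _ _ f f' g := Hom.add_comp f f' g
  comp_add _ _ _ f g g' := Hom.comp_add f g g'

noncomputable instance : Linear k P.Cat where
  homModule X Y := inferInstanceAs (Module k (P.Hom X.word Y.word))
  smul_comp _ _ _ a f g := Hom.smul_comp a f g
  comp_smul _ _ _ f a g := Hom.comp_smul f a g

noncomputable instance : Supercategory k P.Cat where
  part i X Y := Hom.part P i X.word Y.word
  isCompl X Y := Hom.isCompl_part X.word Y.word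
  id_mem _ := Hom.of_mem_part Diagram.id
  comp_mem := Hom.comp_mem_part

/-- The morphism of the presented supercategory given by a string diagram. -/
noncomputable def ofDiagram (P : Presentation k Ob) {X Y : List Ob} (d : Diagram P.sig X Y) :
    (⟨X⟩ : P.Cat) ⟶ ⟨Y⟩ :=
  Hom.of P d

/-- `1_A ⊗ f`. -/
noncomputable def whiskerL (A : P.Cat) {X Y : P.Cat} (f : X ⟶ Y) :
    (⟨A.word ++ X.word⟩ : P.Cat) ⟶ ⟨A.word ++ Y.word⟩ :=
  Hom.whiskerL A.word f

/-- `f ⊗ 1_B`. -/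
noncomputable def whiskerR {X Y : P.Cat} (f : X ⟶ Y) (B : P.Cat) :
    (⟨X.word ++ B.word⟩ : P.Cat) ⟶ ⟨Y.word ++ B.word⟩ :=
  Hom.whiskerR B.word f

/-- The tensor product `f ⊗ g = (f ⊗ 1) ∘ (1 ⊗ g)` of morphisms. -/
noncomputable def tensorHom {X X' Y Y' : P.Cat} (f : X ⟶ X') (g : Y ⟶ Y') :
    (⟨X.word ++ Y.word⟩ : P.Cat) ⟶ ⟨X'.word ++ Y'.word⟩ :=
  whiskerL X g ≫ whiskerR f Y'

theorem whiskerL_comp (A : P.Cat) {X Y Z : P.Cat} (f : X ⟶ Y) (g : Y ⟶ Z) :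
    whiskerL A (f ≫ g) = whiskerL A f ≫ whiskerL A g := Hom.whiskerL_comp A.word f g

theorem whiskerR_comp (B : P.Cat) {X Y Z : P.Cat} (f : X ⟶ Y) (g : Y ⟶ Z) :
    whiskerR (f ≫ g) B = whiskerR f B ≫ whiskerR g B := Hom.whiskerR_comp B.word f g

theorem whiskerL_id (A X : P.Cat) : whiskerL A (𝟙 X) = 𝟙 _ := Hom.whiskerL_of A.word Diagram.id

theorem whiskerR_id (X B : P.Cat) : whiskerR (𝟙 X) B = 𝟙 _ := Hom.whiskerR_of B.word Diagram.id

theorem whiskerL_add (A : P.Cat) {X Y : P.Cat} (f g : X ⟶ Y) :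
    whiskerL A (f + g) = whiskerL A f + whiskerL A g := map_add (Hom.whiskerL (P := P) A.word) f g

theorem whiskerR_add (B : P.Cat) {X Y : P.Cat} (f g : X ⟶ Y) :
    whiskerR (f + g) B = whiskerR f B + whiskerR g B := map_add (Hom.whiskerR (P := P) B.word) f g

theorem whiskerL_smul (A : P.Cat) {X Y : P.Cat} (a : k) (f : X ⟶ Y) :
    whiskerL A (a • f) = a • whiskerL A f := map_smul (Hom.whiskerL (P := P) A.word) a f

theorem whiskerR_smul (B : P.Cat) {X Y : P.Cat} (a : k) (f : X ⟶ Y) :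
    whiskerR (a • f) B = a • whiskerR f B := map_smul (Hom.whiskerR (P := P) B.word) a f

/-- Two linear operations on morphisms that agree on string diagrams up to equalities of words
agree up to `eqToHom`. -/
theorem eq_of_castEq {X Y U V U' V' : P.Cat} (L : P.Hom X.word Y.word →ₗ[k] P.Hom U.word V.word)
    (L' : P.Hom X.word Y.word →ₗ[k] P.Hom U'.word V'.word) (hU : U = U') (hV : V = V')
    (F : Diagram P.sig X.word Y.word → Diagram P.sig U.word V.word)
    (F' : Diagram P.sig X.word Y.word → Diagram P.sig U'.word V'.word)
    (hF : ∀ d, L (Hom.of P d) = Hom.of P (F d)) (hF' : ∀ d, L' (Hom.of P d) = Hom.of P (F' d))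
    (h : ∀ d, (F d).CastEq (F' d)) (f : X ⟶ Y) (l : U ⟶ V) (l' : U' ⟶ V')
    (hl : l = L f) (hl' : l' = L' f) :
    l = eqToHom hU ≫ l' ≫ eqToHom hV.symm := by
  subst hU hV hl hl'
  rw [eqToHom_refl, eqToHom_refl, Category.id_comp, Category.comp_id]
  refine Hom.induction (P := P) (Q := fun f => L f = L' f) f ?_ ?_ ?_ ?_
  · rw [map_zero, map_zero]
  · intro f g hf hg; rw [map_add, map_add, hf, hg]
  · intro a f hf; rw [map_smul, map_smul, hf]
  · intro d
    rw [hF, hF']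
    obtain ⟨_, _, h⟩ := h d
    rw [h]
    exact congrArg _ (Diagram.id_comp _)

theorem whiskerL_append (A B : P.Cat) {X Y : P.Cat} (f : X ⟶ Y) :
    whiskerL ⟨A.word ++ B.word⟩ f =
      eqToHom (congrArg Cat.mk (List.append_assoc A.word B.word X.word)) ≫
        whiskerL A (whiskerL B f) ≫
          eqToHom (congrArg Cat.mk (List.append_assoc A.word B.word Y.word)).symm :=
  eq_of_castEq (U := ⟨_⟩) (V := ⟨_⟩) (U' := ⟨_⟩) (V' := ⟨_⟩)
    (Hom.whiskerL (A.word ++ B.word)) (Hom.whiskerL A.word ∘ₗ Hom.whiskerL B.word)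
    (congrArg Cat.mk (List.append_assoc _ _ _)) (congrArg Cat.mk (List.append_assoc _ _ _))
    (fun d => d.whiskerL _) (fun d => (d.whiskerL _).whiskerL _) (fun d => Hom.whiskerL_of _ d)
    (fun d => by rw [LinearMap.comp_apply, Hom.whiskerL_of, Hom.whiskerL_of])
    (fun d => Diagram.whiskerL_append _ _ d) f _ _ rfl rfl

theorem whiskerR_append (A B : P.Cat) {X Y : P.Cat} (f : X ⟶ Y) :
    whiskerR (whiskerR f A) B =
      eqToHom (congrArg Cat.mk (List.append_assoc X.word A.word B.word)) ≫
        whiskerR f ⟨A.word ++ B.word⟩ ≫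
          eqToHom (congrArg Cat.mk (List.append_assoc Y.word A.word B.word)).symm :=
  eq_of_castEq (U := ⟨_⟩) (V := ⟨_⟩) (U' := ⟨_⟩) (V' := ⟨_⟩)
    (Hom.whiskerR B.word ∘ₗ Hom.whiskerR A.word) (Hom.whiskerR (A.word ++ B.word))
    (congrArg Cat.mk (List.append_assoc _ _ _)) (congrArg Cat.mk (List.append_assoc _ _ _))
    (fun d => (d.whiskerR _).whiskerR _) (fun d => d.whiskerR _)
    (fun d => by rw [LinearMap.comp_apply, Hom.whiskerR_of, Hom.whiskerR_of])
    (fun d => Hom.whiskerR_of _ d)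
    (fun d => Diagram.whiskerR_append _ _ d) f _ _ rfl rfl

theorem whiskerL_whiskerR (A B : P.Cat) {X Y : P.Cat} (f : X ⟶ Y) :
    whiskerR (whiskerL A f) B =
      eqToHom (congrArg Cat.mk (List.append_assoc A.word X.word B.word)) ≫
        whiskerL A (whiskerR f B) ≫
          eqToHom (congrArg Cat.mk (List.append_assoc A.word Y.word B.word)).symm :=
  eq_of_castEq (U := ⟨_⟩) (V := ⟨_⟩) (U' := ⟨_⟩) (V' := ⟨_⟩)
    (Hom.whiskerR B.word ∘ₗ Hom.whiskerL A.word) (Hom.whiskerL A.word ∘ₗ Hom.whiskerR B.word)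
    (congrArg Cat.mk (List.append_assoc _ _ _)) (congrArg Cat.mk (List.append_assoc _ _ _))
    (fun d => (d.whiskerL _).whiskerR _) (fun d => (d.whiskerR _).whiskerL _)
    (fun d => by rw [LinearMap.comp_apply, Hom.whiskerL_of, Hom.whiskerR_of])
    (fun d => by rw [LinearMap.comp_apply, Hom.whiskerR_of, Hom.whiskerL_of])
    (fun d => Diagram.whiskerL_whiskerR _ _ d) f _ _ rfl rfl

theorem whiskerL_nil {X Y : P.Cat} (f : X ⟶ Y) : whiskerL ⟨[]⟩ f = f := by
  refine (eq_of_castEq (U := ⟨_⟩) (V := ⟨_⟩) (U' := ⟨_⟩) (V' := ⟨_⟩)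
    (Hom.whiskerL []) LinearMap.id rfl rfl (fun d => d.whiskerL _) (fun d => d)
    (fun d => Hom.whiskerL_of _ d) (fun _ => rfl)
    (fun d => ⟨rfl, rfl, ?_⟩) f _ _ rfl rfl).trans (by simp)
  rw [Diagram.whiskerL_nil]
  exact (Diagram.id_comp _).symm

theorem whiskerR_nil {X Y : P.Cat} (f : X ⟶ Y) :
    whiskerR f ⟨[]⟩ = eqToHom (congrArg Cat.mk (List.append_nil X.word)) ≫ f ≫
      eqToHom (congrArg Cat.mk (List.append_nil Y.word)).symm :=
  eq_of_castEq (U := ⟨_⟩) (V := ⟨_⟩) (U' := ⟨_⟩) (V' := ⟨_⟩)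
    (Hom.whiskerR []) LinearMap.id (congrArg Cat.mk (List.append_nil _)) (congrArg Cat.mk (List.append_nil _))
    (fun d => d.whiskerR _) (fun d => d)
    (fun d => Hom.whiskerR_of _ d) (fun _ => rfl) (fun d => Diagram.whiskerR_nil d) f _ _ rfl rfl

theorem tensorHom_interchange {X X' X'' Y Y' Y'' : P.Cat} {i j : ZMod 2} (f : X ⟶ X')
    (f' : X' ⟶ X'') (g' : Y ⟶ Y') (g : Y' ⟶ Y'') (hf : f ∈ Hom.part P i X.word X'.word)
    (hg : g ∈ Hom.part P j Y'.word Y''.word) :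
    tensorHom f g' ≫ tensorHom f' g = superSign k i j • tensorHom (f ≫ f') (g' ≫ g) := by
  have h : whiskerR f Y' ≫ whiskerL X' g =
      superSign k i j • (whiskerL X g ≫ whiskerR f Y'') := Hom.interchange hf hg
  have h' := congrArg (fun t => whiskerL X g' ≫ t ≫ whiskerR f' Y'') h
  simpa [tensorHom, whiskerL_comp, whiskerR_comp] using h'

noncomputable instance : StrictMonoidalSupercategory k P.Cat where
  unit := ⟨[]⟩
  tensorObj X Y := ⟨X.word ++ Y.word⟩
  tensorHom := tensorHom
  add_tensor f f' g := by simp [tensorHom, whiskerR_add]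
  tensor_add f g g' := by simp [tensorHom, whiskerL_add]
  smul_tensor a f g := by simp [tensorHom, whiskerR_smul]
  tensor_smul a f g := by simp [tensorHom, whiskerL_smul]
  tensor_mem {X X' Y Y' i j f g} hf hg := by
    rw [add_comm]
    exact Hom.comp_mem_part (Hom.whiskerL_mem_part X.word hg) (Hom.whiskerR_mem_part Y'.word hf)
  tensor_id X Y := by simp [tensorHom, whiskerL_id, whiskerR_id]
  interchange := tensorHom_interchange
  unit_tensorObj _ := rfl
  tensorObj_unit X := congrArg Cat.mk (List.append_nil X.word)
  tensorObj_assoc X Y Z := congrArg Cat.mk (List.append_assoc X.word Y.word Z.word)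
  unit_tensorHom {X Y} f := by
    rw [tensorHom, whiskerR_id, whiskerL_nil]
    exact ((Category.id_comp _).trans rfl).symm
  tensorHom_unit f := by
    rw [tensorHom, whiskerL_id, Category.id_comp]
    exact whiskerR_nil f
  tensorHom_assoc f g h := by
    simp only [tensorHom, whiskerL_comp, whiskerR_comp, whiskerR_append, whiskerL_append,
      whiskerL_whiskerR, Category.assoc, eqToHom_trans_assoc, eqToHom_refl, Category.id_comp]

end Cat
end Presentation

/-! ### Superfunctors induced by maps of presentations -/

/-- A map of generators under which every defining relation of `P` goes to a defining relation
of `P'`. -/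
structure PresentationHom {k : Type u} [CommRing k] {Ob : Type} (P P' : Presentation k Ob) where
  onGen : SigHom P.sig P'.sig
  map_rel : ∀ X Y f, P.rel X Y f → P'.rel X Y (Chain.map onGen f)

namespace PresentationHom

variable {k : Type u} [CommRing k] {Ob : Type} {P P' : Presentation k Ob}
  (Φ : PresentationHom P P') {X Y Z : List Ob}

open Presentation

theorem map_ideal {f : Chain k P.sig X Y} (hf : P.Ideal X Y f) :
    P'.Ideal X Y (Chain.map Φ.onGen f) := by
  induction hf with
  | rel hf => exact .rel (Φ.map_rel _ _ _ hf)
  | interchange f g =>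
    rw [map_sub, map_smul, Chain.map_of, Chain.map_of, Diagram.map_comp, Diagram.map_comp,
      Diagram.map_whiskerL, Diagram.map_whiskerL, Diagram.map_whiskerR, Diagram.map_whiskerR,
      ← Diagram.parity_map Φ.onGen f, ← Diagram.parity_map Φ.onGen g]
    exact .interchange _ _
  | zero => rw [map_zero]; exact .zero _ _
  | add _ _ hf hg => rw [map_add]; exact .add hf hg
  | smul a _ hf => rw [map_smul]; exact .smul a hf
  | comp_left d _ hf => rw [Chain.map_comp, Chain.map_of]; exact .comp_left _ hf
  | comp_right _ e hf => rw [Chain.map_comp, Chain.map_of]; exact .comp_right hf _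
  | whiskerL A _ hf => rw [Chain.map_whiskerL]; exact .whiskerL A hf
  | whiskerR _ B hf => rw [Chain.map_whiskerR]; exact .whiskerR hf B

/-- The induced map on morphism spaces, replacing every generator in a string diagram by its
image. -/
noncomputable def mapHom : P.Hom X Y →ₗ[k] P'.Hom X Y :=
  (P.ideal X Y).mapQ (P'.ideal X Y) (Chain.map Φ.onGen) fun _ hf => Φ.map_ideal hf

theorem mapHom_mk (f : Chain k P.sig X Y) :
    Φ.mapHom (Hom.mk P f) = Hom.mk P' (Chain.map Φ.onGen f) := rfl

theorem mapHom_of (d : Diagram P.sig X Y) :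
    Φ.mapHom (Hom.of P d) = Hom.of P' (d.map Φ.onGen) := by
  rw [Hom.of, mapHom_mk, Chain.map_of, Hom.of]

theorem mapHom_comp (f : P.Hom X Y) (g : P.Hom Y Z) :
    Φ.mapHom (Hom.comp f g) = Hom.comp (Φ.mapHom f) (Φ.mapHom g) := by
  obtain ⟨f, rfl⟩ := Hom.mk_surjective f
  obtain ⟨g, rfl⟩ := Hom.mk_surjective g
  simp only [Hom.comp_mk, mapHom_mk, Chain.map_comp]

theorem mapHom_whiskerL (A : List Ob) (f : P.Hom X Y) :
    Φ.mapHom (Hom.whiskerL A f) = Hom.whiskerL A (Φ.mapHom f) := by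
  obtain ⟨f, rfl⟩ := Hom.mk_surjective f
  simp only [Hom.whiskerL_mk, mapHom_mk, Chain.map_whiskerL]

theorem mapHom_whiskerR (B : List Ob) (f : P.Hom X Y) :
    Φ.mapHom (Hom.whiskerR B f) = Hom.whiskerR B (Φ.mapHom f) := by
  obtain ⟨f, rfl⟩ := Hom.mk_surjective f
  simp only [Hom.whiskerR_mk, mapHom_mk, Chain.map_whiskerR]

theorem mapHom_mem_part {i : ZMod 2} {f : P.Hom X Y} (hf : f ∈ Hom.part P i X Y) :
    Φ.mapHom f ∈ Hom.part P' i X Y := by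
  induction hf using Submodule.span_induction with
  | zero => simp
  | add f f' _ _ hf hf' => rw [map_add]; exact add_mem hf hf'
  | smul a f _ hf => rw [map_smul]; exact Submodule.smul_mem _ _ hf
  | mem f h =>
    obtain ⟨d, rfl, rfl⟩ := h
    rw [mapHom_of, ← Diagram.parity_map Φ.onGen d]
    exact Hom.of_mem_part _

/-- The strict monoidal superfunctor that is the identity on words and is given on string diagrams
by replacing every generator by its image. -/
noncomputable def superfunctor : StrictMonoidalSuperfunctor k P.Cat P'.Cat where
  obj X := ⟨X.word⟩
  map f := Φ.mapHom f
  map_id _ := Φ.mapHom_of Diagram.id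
  map_comp f g := Φ.mapHom_comp f g
  map_add f g := map_add Φ.mapHom f g
  map_smul a f := map_smul Φ.mapHom a f
  map_mem hf := Φ.mapHom_mem_part hf
  obj_unit := rfl
  obj_tensor _ _ := rfl
  map_tensor {X X' Y Y'} f g := by
    rw [eqToHom_refl, eqToHom_refl, Category.id_comp, Category.comp_id]
    refine (Φ.mapHom_comp (Hom.whiskerL X.word g) (Hom.whiskerR Y'.word f)).trans ?_
    rw [mapHom_whiskerL, mapHom_whiskerR]
    rfl

end PresentationHom

/-! ### The quantum isomeric supercategory -/

/-- The generating objects `↑` and `↓`. -/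
inductive Strand : Type
  | up
  | down

namespace QuantumIsomeric

open Strand

/-- The generating morphisms of the quantum isomeric supercategory. -/
inductive QGen : Type
  /-- The positive crossing `↑ ⊗ ↑ ⟶ ↑ ⊗ ↑`. -/
  | posUp
  /-- The negative crossing `↑ ⊗ ↑ ⟶ ↑ ⊗ ↑`. -/
  | negUp
  /-- The negative right crossing `↑ ⊗ ↓ ⟶ ↓ ⊗ ↑`. -/
  | negRight
  /-- The left cap `↓ ⊗ ↑ ⟶ 𝟙`. -/
  | leftCap
  /-- The left cup `𝟙 ⟶ ↑ ⊗ ↓`. -/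
  | leftCup
  /-- The (closed) Clifford token `↑ ⟶ ↑`. -/
  | token

/-- Sources, targets and parities of the generators: only the Clifford token is odd. -/
def QSig : Signature Strand where
  Gen := QGen
  dom
    | .posUp => [up, up]
    | .negUp => [up, up]
    | .negRight => [up, down]
    | .leftCap => [down, up]
    | .leftCup => []
    | .token => [up]
  cod
    | .posUp => [up, up]
    | .negUp => [up, up]
    | .negRight => [down, up]
    | .leftCap => []
    | .leftCup => [up, down]
    | .token => [up]
  par
    | .token => 1
    | _ => 0

/-- The identity diagram on a word. -/
def idDiag (X : List Strand) : Diagram QSig X X := .id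

def posUp : Diagram QSig [up, up] [up, up] := .gen (S := QSig) .posUp
def negUp : Diagram QSig [up, up] [up, up] := .gen (S := QSig) .negUp
def negRight : Diagram QSig [up, down] [down, up] := .gen (S := QSig) .negRight
def leftCap : Diagram QSig [down, up] [] := .gen (S := QSig) .leftCap
def leftCup : Diagram QSig [] [up, down] := .gen (S := QSig) .leftCup
def token : Diagram QSig [up] [up] := .gen (S := QSig) .token

/-- The positive left crossing
`(leftCap ⊗ 1_↑ ⊗ 1_↓) ∘ (1_↓ ⊗ posUp ⊗ 1_↓) ∘ (1_↓ ⊗ 1_↑ ⊗ leftCup) : ↓ ⊗ ↑ ⟶ ↑ ⊗ ↓`. -/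
def posLeft : Diagram QSig [down, up] [up, down] :=
  (leftCup.whiskerL [down, up]).comp
    (((posUp.whiskerL [down]).whiskerR [down]).comp (leftCap.whiskerR [up, down]))

/-- The right cap `leftCap ∘ negRight : ↑ ⊗ ↓ ⟶ 𝟙`. -/
def rightCap : Diagram QSig [up, down] [] := negRight.comp leftCap

/-- `posUp ⊗ 1_↑`. -/
def posUp₁₂ : Diagram QSig [up, up, up] [up, up, up] := posUp.whiskerR [up]

/-- `1_↑ ⊗ posUp`. -/
def posUp₂₃ : Diagram QSig [up, up, up] [up, up, up] := posUp.whiskerL [up]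

/-- `token ⊗ 1_↑`. -/
def token₁ : Diagram QSig [up, up] [up, up] := token.whiskerR [up]

/-- `1_↑ ⊗ token`. -/
def token₂ : Diagram QSig [up, up] [up, up] := token.whiskerL [up]

/-- The clockwise bubble `rightCap ∘ leftCup`. -/
def bubble : Diagram QSig [] [] := leftCup.comp rightCap

/-- The clockwise bubble `rightCap ∘ (token ⊗ 1_↓) ∘ leftCup` with a closed Clifford token. -/
def tokenBubble : Diagram QSig [] [] := leftCup.comp ((token.whiskerR [down]).comp rightCap)

/-- `(1_↑ ⊗ leftCap) ∘ (leftCup ⊗ 1_↑)`. -/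
def zigzagUp : Diagram QSig [up] [up] := (leftCup.whiskerR [up]).comp (leftCap.whiskerL [up])

/-- `(leftCap ⊗ 1_↓) ∘ (1_↓ ⊗ leftCup)`. -/
def zigzagDown : Diagram QSig [down] [down] :=
  (leftCup.whiskerL [down]).comp (leftCap.whiskerR [down])

open Chain in
/-- The defining relations of the quantum isomeric supercategory with parameter `z`.
A relation `a = b` is written as `a - b`. -/
inductive QRel {k : Type u} [CommRing k] (z : k) : ∀ X Y : List Strand, Chain k QSig X Y → Prop
  | neg_pos : QRel z _ _ (of k (posUp.comp negUp) - of k (idDiag [up, up]))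
  | pos_neg : QRel z _ _ (of k (negUp.comp posUp) - of k (idDiag [up, up]))
  | posLeft_negRight : QRel z _ _ (of k (negRight.comp posLeft) - of k (idDiag [up, down]))
  | negRight_posLeft : QRel z _ _ (of k (posLeft.comp negRight) - of k (idDiag [down, up]))
  | braid : QRel z _ _
      (of k (posUp₁₂.comp (posUp₂₃.comp posUp₁₂)) - of k (posUp₂₃.comp (posUp₁₂.comp posUp₂₃)))
  | skein : QRel z _ _ (of k posUp - of k negUp - z • of k (idDiag [up, up]))
  | token_sq : QRel z _ _ (of k (token.comp token) - (-of k (idDiag [up])))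
  | token_slide : QRel z _ _ (of k (token₁.comp posUp) - of k (posUp.comp token₂))
  | token_bubble : QRel z _ _ (of k tokenBubble - 0)
  | bubble : QRel z _ _ (of k bubble - 0)
  | zigzag_up : QRel z _ _ (of k zigzagUp - of k (idDiag [up]))
  | zigzag_down : QRel z _ _ (of k zigzagDown - of k (idDiag [down]))

theorem of_mem {k : Type u} [CommRing k] {S : Signature Strand} {X Y : List Strand} {i : ZMod 2}
    (d : Diagram S X Y) (h : d.parity = i) : Chain.of k d ∈ Chain.part k S i X Y :=
  Submodule.subset_span ⟨d, h, rfl⟩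

theorem parity_idDiag (X : List Strand) : (idDiag X).parity = 0 := rfl
theorem parity_posUp : posUp.parity = 0 := Diagram.parity_gen (S := QSig) .posUp
theorem parity_negUp : negUp.parity = 0 := Diagram.parity_gen (S := QSig) .negUp
theorem parity_negRight : negRight.parity = 0 := Diagram.parity_gen (S := QSig) .negRight
theorem parity_leftCap : leftCap.parity = 0 := Diagram.parity_gen (S := QSig) .leftCap
theorem parity_leftCup : leftCup.parity = 0 := Diagram.parity_gen (S := QSig) .leftCup
theorem parity_token : token.parity = 1 := Diagram.parity_gen (S := QSig) .token

theorem parity_posLeft : posLeft.parity = 0 := by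
  refine (Diagram.parity_comp _ _).trans ?_
  rw [Diagram.parity_comp, Diagram.parity_whiskerR, Diagram.parity_whiskerR,
    Diagram.parity_whiskerL, Diagram.parity_whiskerL, parity_leftCap, parity_leftCup, parity_posUp]
  rfl

theorem parity_rightCap : rightCap.parity = 0 := by
  rw [rightCap, Diagram.parity_comp, parity_negRight, parity_leftCap]; rfl

theorem parity_posUp₁₂ : posUp₁₂.parity = 0 :=
  (Diagram.parity_whiskerR _ _).trans parity_posUp

theorem parity_posUp₂₃ : posUp₂₃.parity = 0 :=
  (Diagram.parity_whiskerL _ _).trans parity_posUp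

theorem parity_token₁ : token₁.parity = 1 := (Diagram.parity_whiskerR _ _).trans parity_token

theorem parity_token₂ : token₂.parity = 1 := (Diagram.parity_whiskerL _ _).trans parity_token

theorem parity_bubble : bubble.parity = 0 := by
  rw [bubble, Diagram.parity_comp, parity_leftCup, parity_rightCap]; rfl

theorem parity_tokenBubble : tokenBubble.parity = 1 := by
  refine (Diagram.parity_comp _ _).trans ?_
  rw [Diagram.parity_comp, Diagram.parity_whiskerR, parity_leftCup, parity_token, parity_rightCap]
  rfl

theorem parity_zigzagUp : zigzagUp.parity = 0 := by
  refine (Diagram.parity_comp _ _).trans ?_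
  rw [Diagram.parity_whiskerR, Diagram.parity_whiskerL, parity_leftCup, parity_leftCap]
  rfl

theorem parity_zigzagDown : zigzagDown.parity = 0 := by
  refine (Diagram.parity_comp _ _).trans ?_
  rw [Diagram.parity_whiskerR, Diagram.parity_whiskerL, parity_leftCup, parity_leftCap]
  rfl

theorem QRel.homogeneous {k : Type u} [CommRing k] (z : k) (X Y : List Strand)
    (f : Chain k QSig X Y) (hf : QRel z X Y f) : ∃ i, f ∈ Chain.part k QSig i X Y := by
  cases hf with
  | token_slide =>
    exact ⟨1, sub_mem
      (of_mem _ (by rw [Diagram.parity_comp, parity_token₁, parity_posUp, add_zero]))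
      (of_mem _ (by rw [Diagram.parity_comp, parity_token₂, parity_posUp, zero_add]))⟩
  | token_bubble => exact ⟨1, sub_mem (of_mem _ parity_tokenBubble) (zero_mem _)⟩
  | bubble => exact ⟨0, sub_mem (of_mem _ parity_bubble) (zero_mem _)⟩
  | token_sq =>
    refine ⟨0, sub_mem (of_mem _ ?_) (neg_mem (of_mem _ (parity_idDiag _)))⟩
    rw [Diagram.parity_comp, parity_token]; rfl
  | skein =>
    exact ⟨0, sub_mem (sub_mem (of_mem _ parity_posUp) (of_mem _ parity_negUp))
      (Submodule.smul_mem _ _ (of_mem _ (parity_idDiag _)))⟩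
  | braid =>
    exact ⟨0, sub_mem
      (of_mem _ (by simp only [Diagram.parity_comp, parity_posUp₁₂, parity_posUp₂₃, add_zero]))
      (of_mem _ (by simp only [Diagram.parity_comp, parity_posUp₁₂, parity_posUp₂₃, add_zero]))⟩
  | zigzag_up => exact ⟨0, sub_mem (of_mem _ parity_zigzagUp) (of_mem _ (parity_idDiag _))⟩
  | zigzag_down => exact ⟨0, sub_mem (of_mem _ parity_zigzagDown) (of_mem _ (parity_idDiag _))⟩
  | _ =>
    exact ⟨0, sub_mem
      (of_mem _ (by simp only [Diagram.parity_comp, parity_posUp, parity_negUp, parity_posLeft,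
        parity_negRight, add_zero])) (of_mem _ (parity_idDiag _))⟩

/-- Presentation of the quantum isomeric supercategory. -/
def QPres {k : Type u} [CommRing k] (z : k) : Presentation k Strand where
  sig := QSig
  rel := QRel z
  homogeneous := QRel.homogeneous z

/-- The quantum isomeric supercategory `Q(z)`. -/
abbrev Q {k : Type u} [CommRing k] (z : k) : Type := (QPres z).Cat

/-! ### The quantum affine isomeric supercategory -/

/-- The generating morphisms of the quantum affine isomeric supercategory: those of the quantum
isomeric supercategory and the open Clifford token. -/
inductive AQGen : Type
  | ofQ (g : QGen)
  /-- The open Clifford token `↑ ⟶ ↑`, which is odd. -/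
  | openToken

def AQSig : Signature Strand where
  Gen := AQGen
  dom
    | .ofQ g => QSig.dom g
    | .openToken => [up]
  cod
    | .ofQ g => QSig.cod g
    | .openToken => [up]
  par
    | .ofQ g => QSig.par g
    | .openToken => 1

/-- The inclusion of the generators. -/
def inclGen : SigHom QSig AQSig where
  toFun := .ofQ
  dom_eq _ := rfl
  cod_eq _ := rfl
  par_eq _ := rfl

def openToken : Diagram AQSig [up] [up] := .gen (S := AQSig) .openToken

/-- `openToken ⊗ 1_↑`. -/
def openToken₁ : Diagram AQSig [up, up] [up, up] := openToken.whiskerR [up]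

/-- `1_↑ ⊗ openToken`. -/
def openToken₂ : Diagram AQSig [up, up] [up, up] := openToken.whiskerL [up]

/-- The clockwise bubble `rightCap ∘ (openToken ⊗ 1_↓) ∘ leftCup` with an open Clifford token. -/
def openTokenBubble : Diagram AQSig [] [] :=
  (leftCup.map inclGen).comp ((openToken.whiskerR [down]).comp (rightCap.map inclGen))

open Chain in
/-- The defining relations of the quantum affine isomeric supercategory: those of the quantum
isomeric supercategory and three relations for the open Clifford token. -/
inductive AQRel {k : Type u} [CommRing k] (z : k) : ∀ X Y : List Strand, Chain k AQSig X Y → Prop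
  | ofQ {X Y : List Strand} {f : Chain k QSig X Y} (hf : QRel z X Y f) :
      AQRel z X Y (Chain.map inclGen f)
  | openToken_sq : AQRel z _ _
      (of k (openToken.comp openToken) - (-of k ((idDiag [up]).map inclGen)))
  | openToken_slide : AQRel z _ _
      (of k (openToken₂.comp (posUp.map inclGen)) - of k ((posUp.map inclGen).comp openToken₁))
  | openToken_bubble : AQRel z _ _ (of k openTokenBubble - 0)

theorem parity_openToken : openToken.parity = 1 := Diagram.parity_gen (S := AQSig) .openToken

theorem parity_openToken₁ : openToken₁.parity = 1 :=
  (Diagram.parity_whiskerR _ _).trans parity_openToken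

theorem parity_openToken₂ : openToken₂.parity = 1 :=
  (Diagram.parity_whiskerL _ _).trans parity_openToken

theorem parity_openTokenBubble : openTokenBubble.parity = 1 := by
  refine (Diagram.parity_comp _ _).trans ?_
  rw [Diagram.parity_comp, Diagram.parity_whiskerR, Diagram.parity_map, Diagram.parity_map,
    parity_leftCup, parity_openToken, parity_rightCap]
  rfl

theorem AQRel.homogeneous {k : Type u} [CommRing k] (z : k) (X Y : List Strand)
    (f : Chain k AQSig X Y) (hf : AQRel z X Y f) : ∃ i, f ∈ Chain.part k AQSig i X Y := by
  cases hf with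
  | ofQ hf =>
    obtain ⟨i, hi⟩ := QRel.homogeneous z X Y _ hf
    exact ⟨i, Chain.map_mem_part inclGen hi⟩
  | openToken_sq =>
    refine ⟨0, sub_mem (of_mem _ ?_) (neg_mem (of_mem _ ?_))⟩
    · rw [Diagram.parity_comp, parity_openToken]; rfl
    · rw [Diagram.parity_map, parity_idDiag]
  | openToken_slide =>
    exact ⟨1, sub_mem
      (of_mem _ (by rw [Diagram.parity_comp, Diagram.parity_map, parity_openToken₂, parity_posUp,
        add_zero]))
      (of_mem _ (by rw [Diagram.parity_comp, Diagram.parity_map, parity_openToken₁, parity_posUp,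
        zero_add]))⟩
  | openToken_bubble => exact ⟨1, sub_mem (of_mem _ parity_openTokenBubble) (zero_mem _)⟩

/-- Presentation of the quantum affine isomeric supercategory. -/
def AQPres {k : Type u} [CommRing k] (z : k) : Presentation k Strand where
  sig := AQSig
  rel := AQRel z
  homogeneous := AQRel.homogeneous z

/-- The quantum affine isomeric supercategory `AQ(z)`. -/
abbrev AQ {k : Type u} [CommRing k] (z : k) : Type := (AQPres z).Cat

/-! ### The natural superfunctor -/

/-- The inclusion of presentations. -/
def inclPres {k : Type u} [CommRing k] (z : k) : PresentationHom (QPres z) (AQPres z) where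
  onGen := inclGen
  map_rel _ _ _ hf := .ofQ hf

/-- The natural strict monoidal superfunctor `Q(z) ⟶ AQ(z)`: it is the identity on objects and
sends each string diagram to the morphism depicted by the same string diagram. -/
noncomputable def natural {k : Type u} [CommRing k] (z : k) :
    StrictMonoidalSuperfunctor k (Q z) (AQ z) :=
  (inclPres z).superfunctor

/-- A generating morphism, as a morphism of `Q(z)`. -/
noncomputable def Q.gen {k : Type u} [CommRing k] (z : k) (g : QGen) :
    (⟨QSig.dom g⟩ : Q z) ⟶ ⟨QSig.cod g⟩ :=
  Presentation.Cat.ofDiagram (QPres z) (.gen (S := QSig) g)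

/-- A generating morphism of `Q(z)`, as a morphism of `AQ(z)`. -/
noncomputable def AQ.gen {k : Type u} [CommRing k] (z : k) (g : QGen) :
    (⟨QSig.dom g⟩ : AQ z) ⟶ ⟨QSig.cod g⟩ :=
  Presentation.Cat.ofDiagram (AQPres z) (.gen (S := AQSig) (.ofQ g))

end QuantumIsomeric

namespace QuantumIsomeric

open Strand Presentation

variable {k : Type u} [CommRing k] {z : k}

/-! ### Morphisms of `Q(z)` acting on the left of a word -/

/-! The idea is to let `AQ(z)` act on `Q(z)` and to evaluate the action at the unit object. A word
`X` acts by the functor `X ⊗ -`, and a generator of `Q(z)` acts by tensoring on the left. The open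
token must act on `↑ ⊗ -` by an odd supernatural endomorphism, that is, by a family of odd maps
`openTok z C : ↑ ⊗ C ⟶ ↑ ⊗ C` that supercommute with every `1_↑ ⊗ h`. Given such an action, a
morphism of `Q(z)` whose image in `AQ(z)` is zero acts by zero. At the empty word it acts by itself,
so it was already zero.

The family is obtained by carrying the upward strand across `C`, applying `tau` at the far right,
and carrying the strand back. Since this is a conjugation, `openTok_sq` reduces to the square of the
closed token. The recursion on a leading `↑` makes the slide relation `openTok_comp_pos` immediate.

Two points need work. The first is supernaturality (`Commutes`), which is checked on the generators.
The positive crossing uses the braid relation, and the closed token slides to a place where it meets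
the open one with a sign. Cups and caps require the return crossing past `↓` to be a rotation of the
negative upward crossing, as in `negLeftCross_eq`. This rotated crossing is invertible because the
clockwise bubble vanishes.

The second point is the bubble relation, which becomes the vanishing of a clockwise bubble
encircling `C` (`encircle_eq_zero`). Upward strands can be pulled out of the bubble, downward
strands are treated by duality, and at the empty word the claim is the token bubble relation of
`Q(z)`.

The action then extends to diagrams and their linear combinations. `chainAct_ideal` shows that it
kills the defining ideal of `AQ(z)`, with the super interchange law coming from supernaturality, and
`chainAct_map` recovers a morphism of `Q(z)` at the empty word. -/

theorem whiskerL_cons {S : Signature Strand} (a : Strand) (A : List Strand) {X Y : List Strand}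
    (d : Diagram S X Y) : d.whiskerL (a :: A) = (d.whiskerL A).whiskerL [a] := by
  induction d with
  | id => rfl
  | snoc d l ih => simp only [Diagram.whiskerL, ih]; rfl

/-- Morphisms of `Q(z)` between words. -/
abbrev Mor (z : k) (X Y : List Strand) : Type u := (⟨X⟩ : Q z) ⟶ ⟨Y⟩

/-- The morphism `1_a ⊗ f`, for a generating object `a`. -/
noncomputable def cons (a : Strand) {X Y : List Strand} (f : Mor z X Y) :
    Mor z (a :: X) (a :: Y) :=
  Cat.whiskerL (P := QPres z) ⟨[a]⟩ f

section cons

variable (a : Strand) {X Y Z : List Strand}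

@[simp] theorem cons_id : cons a (𝟙 (⟨X⟩ : Q z)) = 𝟙 (⟨a :: X⟩ : Q z) := Cat.whiskerL_id _ _

theorem cons_comp (f : Mor z X Y) (g : Mor z Y Z) : cons a (f ≫ g) = cons a f ≫ cons a g :=
  Cat.whiskerL_comp _ f g

theorem cons_add (f g : Mor z X Y) : cons a (f + g) = cons a f + cons a g :=
  Cat.whiskerL_add _ f g

theorem cons_smul (c : k) (f : Mor z X Y) : cons a (c • f) = c • cons a f :=
  Cat.whiskerL_smul _ c f

theorem cons_neg (f : Mor z X Y) : cons a (-f) = -cons a f := by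
  rw [← neg_one_smul k, cons_smul, neg_one_smul]

theorem cons_sub (f g : Mor z X Y) : cons a (f - g) = cons a f - cons a g := by
  rw [sub_eq_add_neg, cons_add, cons_neg, sub_eq_add_neg]

@[simp] theorem cons_zero : cons a (0 : Mor z X Y) = 0 := by
  rw [← zero_smul k (0 : Mor z X Y), cons_smul, zero_smul]

theorem cons_mem_part {i : ZMod 2} {f : Mor z X Y} (hf : f ∈ Hom.part (QPres z) i X Y) :
    cons a f ∈ Hom.part (QPres z) i (a :: X) (a :: Y) :=
  Hom.whiskerL_mem_part [a] hf

end cons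

/-- The morphism `1_A ⊗ f`. -/
noncomputable def whisk : ∀ (A : List Strand) {X Y : List Strand}, Mor z X Y →
    Mor z (A ++ X) (A ++ Y)
  | [], _, _, f => f
  | a :: A, _, _, f => cons a (whisk A f)

/-- The recursion in `whisk` makes `whisk [a, b] h` unfold to `cons a (cons b h)`, so that
naturality squares for concrete generators hold without casts. This comparison supplies linearity,
functoriality and parity. -/
theorem whisk_eq (A : List Strand) {X Y : List Strand} (f : Mor z X Y) :
    whisk A f = Cat.whiskerL (P := QPres z) ⟨A⟩ f := by
  induction A with
  | nil => exact (Cat.whiskerL_nil f).symm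
  | cons a A ih =>
    refine (congrArg (cons a) ih).trans ?_
    refine Hom.induction (P := QPres z)
      (Q := fun f => Hom.whiskerL [a] (Hom.whiskerL A f) = Hom.whiskerL (a :: A) f) f ?_ ?_ ?_ ?_
    · rw [map_zero, map_zero, map_zero]
    · intro f g hf hg; rw [map_add, map_add, map_add, hf, hg]
    · intro c f hf; rw [map_smul, map_smul, map_smul, hf]
    · intro d
      rw [Hom.whiskerL_of A d, Hom.whiskerL_of (a :: A) d, whiskerL_cons]
      exact Hom.whiskerL_of [a] _

section whisk

variable (A : List Strand) {X Y Z : List Strand}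

theorem whisk_comp (f : Mor z X Y) (g : Mor z Y Z) : whisk A (f ≫ g) = whisk A f ≫ whisk A g := by
  simp only [whisk_eq]; exact Cat.whiskerL_comp _ f g

theorem whisk_add (f g : Mor z X Y) : whisk A (f + g) = whisk A f + whisk A g := by
  simp only [whisk_eq]; exact Cat.whiskerL_add _ f g

theorem whisk_smul (c : k) (f : Mor z X Y) : whisk A (c • f) = c • whisk A f := by
  simp only [whisk_eq]; exact Cat.whiskerL_smul _ c f

theorem whisk_zero : whisk A (0 : Mor z X Y) = 0 := by
  rw [← zero_smul k (0 : Mor z X Y), whisk_smul, zero_smul]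

theorem whisk_mem_part {i : ZMod 2} {f : Mor z X Y} (hf : f ∈ Hom.part (QPres z) i X Y) :
    whisk A f ∈ Hom.part (QPres z) i (A ++ X) (A ++ Y) := by
  rw [whisk_eq]; exact Hom.whiskerL_mem_part A hf

end whisk

/-- The morphism `g ⊗ 1_C`, for a generating morphism `g`. -/
noncomputable def genAt (z : k) (g : QGen) (C : List Strand) :
    Mor z (QSig.dom g ++ C) (QSig.cod g ++ C) :=
  Cat.ofDiagram (QPres z) ((Diagram.gen (S := QSig) g).whiskerR C)

theorem genAt_mem_part (g : QGen) (C : List Strand) :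
    genAt z g C ∈ Hom.part (QPres z) (QSig.par g) (QSig.dom g ++ C) (QSig.cod g ++ C) :=
  Submodule.subset_span ⟨_, (Diagram.parity_whiskerR _ _).trans (Diagram.parity_gen (S := QSig) g), rfl⟩

/-- This is the super interchange law with a generator as the left factor. It makes each generator a
supernatural transformation between the functors `dom g ⊗ -` and `cod g ⊗ -`. -/
theorem genAt_comp_whisk (g : QGen) {j : ZMod 2} {C C' : List Strand} {h : Mor z C C'}
    (hh : h ∈ Hom.part (QPres z) j C C') :
    genAt z g C ≫ whisk (QSig.cod g) h =
      superSign k (QSig.par g) j • (whisk (QSig.dom g) h ≫ genAt z g C') := by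
  rw [whisk_eq, whisk_eq]
  have := Hom.interchange (P := QPres z) (f := Hom.of (QPres z) (Diagram.gen (S := QSig) g))
    (Submodule.subset_span ⟨_, Diagram.parity_gen (S := QSig) g, rfl⟩) hh
  have h' : ∀ B, Hom.whiskerR B (Hom.of (QPres z) (Diagram.gen (S := QSig) g)) = genAt z g B :=
    fun B => Hom.whiskerR_of (P := QPres z) B (Diagram.gen (S := QSig) g)
  rw [h', h'] at this
  exact this

theorem superSign_zero_left (j : ZMod 2) : superSign k 0 j = 1 := by simp [superSign]

theorem superSign_add_left (i i' j : ZMod 2) :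
    superSign k (i + i') j = superSign k i j * superSign k i' j := by
  have h : ∀ i i' j : ZMod 2, ((i + i').val * j.val) % 2 = (i.val * j.val + i'.val * j.val) % 2 := by
    decide
  rw [superSign, superSign, superSign, ← pow_add, neg_one_pow_eq_pow_mod_two, h,
    ← neg_one_pow_eq_pow_mod_two]

theorem superSign_comm (i j : ZMod 2) : superSign k i j = superSign k j i := by
  rw [superSign, superSign, mul_comm]

theorem superSign_add_right (i j j' : ZMod 2) :
    superSign k i (j + j') = superSign k i j * superSign k i j' := by
  rw [superSign_comm, superSign_add_left, superSign_comm j, superSign_comm j']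

theorem superSign_one_one : superSign k 1 1 = -1 := pow_one _

theorem superSign_mul_self (i j : ZMod 2) : superSign k i j * superSign k i j = 1 := by
  rw [superSign, ← mul_pow]; simp

/-- An even generator slides past every morphism. -/
theorem genAt_comp_whisk_of_even (g : QGen) (hg : QSig.par g = 0) {C C' : List Strand}
    (h : Mor z C C') :
    genAt z g C ≫ whisk (QSig.cod g) h = whisk (QSig.dom g) h ≫ genAt z g C' := by
  refine Hom.induction (P := QPres z) (Q := fun h : Mor z C C' =>
    genAt z g C ≫ whisk (QSig.cod g) h = whisk (QSig.dom g) h ≫ genAt z g C') h ?_ ?_ ?_ ?_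
  · exact (congrArg _ (whisk_zero _)).trans (Limits.comp_zero.trans
      ((congrArg (· ≫ genAt z g C') (whisk_zero _)).trans Limits.zero_comp).symm)
  · intro f f' hf hf'
    refine (congrArg (genAt z g C ≫ ·) (whisk_add _ f f')).trans (Eq.trans ?_
      (congrArg (· ≫ genAt z g C') (whisk_add _ f f')).symm)
    simp only [Preadditive.comp_add, Preadditive.add_comp, hf, hf']
  · intro c f hf
    refine (congrArg (genAt z g C ≫ ·) (whisk_smul _ c f)).trans (Eq.trans ?_
      (congrArg (· ≫ genAt z g C') (whisk_smul _ c f)).symm)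
    simp only [Linear.comp_smul, Linear.smul_comp, hf]
  · intro d
    have := genAt_comp_whisk g (Hom.of_mem_part (P := QPres z) d)
    rwa [hg, superSign_zero_left, one_smul] at this

/-! ### Generators acting at the left end of a word -/

section generators

variable (z) (C : List Strand)

/-- The positive crossing on the left of the word `C`. -/
noncomputable def pos : Mor z (up :: up :: C) (up :: up :: C) := genAt z .posUp C
/-- The negative crossing on the left of the word `C`. -/
noncomputable def neg : Mor z (up :: up :: C) (up :: up :: C) := genAt z .negUp C
/-- The negative right crossing on the left of the word `C`. -/
noncomputable def rightCross : Mor z (up :: down :: C) (down :: up :: C) := genAt z .negRight C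
/-- The left cap on the left of the word `C`. -/
noncomputable def cap : Mor z (down :: up :: C) C := genAt z .leftCap C
/-- The left cup on the left of the word `C`. -/
noncomputable def cup : Mor z C (up :: down :: C) := genAt z .leftCup C
/-- The closed Clifford token on the left of the word `C`. -/
noncomputable def tok : Mor z (up :: C) (up :: C) := genAt z .token C
/-- The positive left crossing on the left of the word `C`. -/
noncomputable def leftCross : Mor z (down :: up :: C) (up :: down :: C) :=
  cons down (cons up (cup z C)) ≫ cons down (pos z (down :: C)) ≫ cap z (up :: down :: C)

end generators

/-- Applying `1_a ⊗ -` to a commutative square. -/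
theorem cons_square (a : Strand) {W X Y Z : List Strand} {f : Mor z W X} {g : Mor z X Z}
    {f' : Mor z W Y} {g' : Mor z Y Z} (h : f ≫ g = f' ≫ g') :
    cons a f ≫ cons a g = cons a f' ≫ cons a g' := by
  rw [← cons_comp, h, cons_comp]

/-! ### Naturality of the generators in the remaining word -/

section naturality

variable {C C' : List Strand} (h : Mor z C C')

theorem pos_naturality :
    pos z C ≫ cons up (cons up h) = cons up (cons up h) ≫ pos z C' :=
  genAt_comp_whisk_of_even .posUp rfl h

theorem neg_naturality :
    neg z C ≫ cons up (cons up h) = cons up (cons up h) ≫ neg z C' :=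
  genAt_comp_whisk_of_even .negUp rfl h

theorem rightCross_naturality :
    rightCross z C ≫ cons down (cons up h) = cons up (cons down h) ≫ rightCross z C' :=
  genAt_comp_whisk_of_even .negRight rfl h

theorem cap_naturality :
    cap z C ≫ h = cons down (cons up h) ≫ cap z C' :=
  genAt_comp_whisk_of_even .leftCap rfl h

theorem cup_naturality :
    cup z C ≫ cons up (cons down h) = h ≫ cup z C' :=
  genAt_comp_whisk_of_even .leftCup rfl h

theorem tok_naturality {j : ZMod 2} (hh : h ∈ Hom.part (QPres z) j C C') :
    tok z C ≫ cons up h = superSign k 1 j • (cons up h ≫ tok z C') :=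
  genAt_comp_whisk .token hh

theorem leftCross_naturality :
    leftCross z C ≫ cons up (cons down h) = cons down (cons up h) ≫ leftCross z C' := by
  simp only [leftCross, Category.assoc, cap_naturality]
  rw [reassoc_of% cons_square down (pos_naturality (cons down h)),
    reassoc_of% cons_square down (cons_square up (cup_naturality h))]

end naturality

/-- The morphism of `Q(z)` represented by `f ⊗ 1_C`. -/
noncomputable def toMor (C : List Strand) {X Y : List Strand} :
    Chain k QSig X Y →ₗ[k] Mor z (X ++ C) (Y ++ C) :=
  (Hom.mk (QPres z)).comp (Chain.whiskerR C)

theorem toMor_of (C : List Strand) {X Y : List Strand} (d : Diagram QSig X Y) :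
    toMor C (Chain.of k d) = (Cat.ofDiagram (QPres z) (d.whiskerR C) : Mor z _ _) :=
  Hom.whiskerR_of (P := QPres z) C d

theorem toMor_eq_zero {X Y : List Strand} {f : Chain k QSig X Y} (hf : QRel z X Y f)
    (C : List Strand) : toMor C f = (0 : Mor z _ _) :=
  Hom.mk_eq_zero.2 (.whiskerR (.rel (P := QPres z) hf) C)

theorem of_whiskerR_eq {X Y : List Strand} {d e : Diagram QSig X Y}
    (hf : QRel z X Y (Chain.of k d - Chain.of k e)) (C : List Strand) :
    (Cat.ofDiagram (QPres z) (d.whiskerR C) : Mor z _ _) =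
      Cat.ofDiagram (QPres z) (e.whiskerR C) := by
  have h := toMor_eq_zero hf C
  rwa [map_sub, sub_eq_zero, toMor_of, toMor_of] at h

theorem ofDiagram_comp {X Y Z : List Strand} (d : Diagram QSig X Y) (e : Diagram QSig Y Z) :
    (Cat.ofDiagram (QPres z) (d.comp e) : Mor z X Z) =
      (Cat.ofDiagram (QPres z) d : Mor z X Y) ≫ (Cat.ofDiagram (QPres z) e : Mor z Y Z) :=
  (Hom.comp_of (P := QPres z) d e).symm

theorem cons_ofDiagram (a : Strand) {X Y : List Strand} (d : Diagram QSig X Y) :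
    cons a (Cat.ofDiagram (QPres z) d : Mor z X Y) = Cat.ofDiagram (QPres z) (d.whiskerL [a]) :=
  Hom.whiskerL_of (P := QPres z) [a] d

/-! ### The defining relations, tensored on the right with an arbitrary word -/

section relations

variable (z) (C : List Strand)

theorem pos_comp_neg : pos z C ≫ neg z C = 𝟙 _ := by
  have h := of_whiskerR_eq (.neg_pos (z := z)) C
  rw [Diagram.whiskerR_comp, ofDiagram_comp] at h
  exact h

theorem neg_comp_pos : neg z C ≫ pos z C = 𝟙 _ := by
  have h := of_whiskerR_eq (.pos_neg (z := z)) C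
  rw [Diagram.whiskerR_comp, ofDiagram_comp] at h
  exact h

theorem ofDiagram_posLeft :
    (Cat.ofDiagram (QPres z) (posLeft.whiskerR C) : Mor z _ _) = leftCross z C := by
  have h1 : (Cat.ofDiagram (QPres z) ((leftCup.whiskerL [down, up]).whiskerR C) : Mor z _ _) =
      cons down (cons up (cup z C)) :=
    ((congrArg (cons down) (cons_ofDiagram up (leftCup.whiskerR C))).trans
      (cons_ofDiagram down ((leftCup.whiskerR C).whiskerL [up]))).symm
  have h2 : (Cat.ofDiagram (QPres z) (((posUp.whiskerL [down]).whiskerR [down]).whiskerR C) :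
      Mor z _ _) = cons down (pos z (down :: C)) :=
    (cons_ofDiagram down (posUp.whiskerR (down :: C))).symm
  rw [posLeft, Diagram.whiskerR_comp, Diagram.whiskerR_comp, ofDiagram_comp, ofDiagram_comp,
    leftCross, h1, h2]
  rfl

theorem rightCross_comp_leftCross : rightCross z C ≫ leftCross z C = 𝟙 _ := by
  have h := of_whiskerR_eq (.posLeft_negRight (z := z)) C
  rw [Diagram.whiskerR_comp, ofDiagram_comp, ofDiagram_posLeft] at h
  exact h

theorem leftCross_comp_rightCross : leftCross z C ≫ rightCross z C = 𝟙 _ := by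
  have h := of_whiskerR_eq (.negRight_posLeft (z := z)) C
  rw [Diagram.whiskerR_comp, ofDiagram_comp, ofDiagram_posLeft] at h
  exact h

theorem braid : pos z (up :: C) ≫ cons up (pos z C) ≫ pos z (up :: C) =
    cons up (pos z C) ≫ pos z (up :: C) ≫ cons up (pos z C) := by
  have h := of_whiskerR_eq (.braid (z := z)) C
  simp only [Diagram.whiskerR_comp, ofDiagram_comp] at h
  have h1 : (Cat.ofDiagram (QPres z) (posUp₁₂.whiskerR C) : Mor z _ _) = pos z (up :: C) := rfl
  have h2 : (Cat.ofDiagram (QPres z) (posUp₂₃.whiskerR C) : Mor z _ _) = cons up (pos z C) :=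
    (cons_ofDiagram up (posUp.whiskerR C)).symm
  rw [h1, h2] at h
  exact h

theorem skein : pos z C - neg z C = z • 𝟙 _ := by
  have h := toMor_eq_zero (.skein (z := z)) C
  simp only [map_sub, map_smul, toMor_of] at h
  exact sub_eq_zero.1 h

theorem tok_sq : tok z C ≫ tok z C = -𝟙 _ := by
  have h := toMor_eq_zero (.token_sq (z := z)) C
  simp only [map_sub, map_neg, toMor_of, sub_eq_zero, Diagram.whiskerR_comp, ofDiagram_comp] at h
  exact h

theorem tok_comp_pos : tok z (up :: C) ≫ pos z C = pos z C ≫ cons up (tok z C) := by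
  have h := of_whiskerR_eq (.token_slide (z := z)) C
  simp only [Diagram.whiskerR_comp, ofDiagram_comp] at h
  have h2 : (Cat.ofDiagram (QPres z) (token₂.whiskerR C) : Mor z _ _) = cons up (tok z C) :=
    (cons_ofDiagram up (token.whiskerR C)).symm
  rw [h2] at h
  exact h

theorem ofDiagram_rightCap :
    (Cat.ofDiagram (QPres z) (rightCap.whiskerR C) : Mor z _ _) = rightCross z C ≫ cap z C := by
  rw [rightCap, Diagram.whiskerR_comp, ofDiagram_comp]; rfl

theorem bubble_eq_zero : cup z C ≫ rightCross z C ≫ cap z C = 0 := by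
  have h := toMor_eq_zero (.bubble (z := z)) C
  rw [sub_zero, toMor_of, QuantumIsomeric.bubble, Diagram.whiskerR_comp, ofDiagram_comp,
    ofDiagram_rightCap] at h
  exact h

theorem tok_bubble_eq_zero :
    cup z C ≫ tok z (down :: C) ≫ rightCross z C ≫ cap z C = 0 := by
  have h := toMor_eq_zero (.token_bubble (z := z)) C
  rw [sub_zero, toMor_of, tokenBubble, Diagram.whiskerR_comp, Diagram.whiskerR_comp,
    ofDiagram_comp, ofDiagram_comp, ofDiagram_rightCap] at h
  exact h

theorem cup_comp_cap : cup z (up :: C) ≫ cons up (cap z C) = 𝟙 _ := by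
  have h := of_whiskerR_eq (.zigzag_up (z := z)) C
  rw [zigzagUp, Diagram.whiskerR_comp, ofDiagram_comp] at h
  refine Eq.trans ?_ h
  exact congrArg (cup z (up :: C) ≫ ·) (cons_ofDiagram up (leftCap.whiskerR C))

theorem cons_cup_comp_cap : cons down (cup z C) ≫ cap z (down :: C) = 𝟙 _ := by
  have h := of_whiskerR_eq (.zigzag_down (z := z)) C
  rw [zigzagDown, Diagram.whiskerR_comp, ofDiagram_comp] at h
  refine Eq.trans ?_ h
  exact congrArg (· ≫ cap z (down :: C)) (cons_ofDiagram down (leftCup.whiskerR C))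

end relations

/-! ### Consequences of the relations -/

section

variable (z) (C : List Strand)

/-- The negative left crossing on the left of the word `C`. -/
noncomputable def negLeftCross : Mor z (down :: up :: C) (up :: down :: C) :=
  leftCross z C - z • (cap z C ≫ cup z C)

/-- The inverse of the negative left crossing on the left of the word `C`. -/
noncomputable def posRightCross : Mor z (up :: down :: C) (down :: up :: C) :=
  rightCross z C + z • (rightCross z C ≫ cap z C ≫ cup z C ≫ rightCross z C)

/-- The formula for `posRightCross` is a geometric series for the inverse of `leftCross - z • (cap ≫
cup)`. It stops after the linear term because the next term contains the clockwise bubble `cup ≫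
rightCross ≫ cap`, which is zero. -/
theorem negLeftCross_comp_posRightCross : negLeftCross z C ≫ posRightCross z C = 𝟙 _ := by
  simp only [negLeftCross, posRightCross, Preadditive.sub_comp, Preadditive.comp_add,
    Linear.smul_comp, Linear.comp_smul, Category.assoc, leftCross_comp_rightCross,
    reassoc_of% leftCross_comp_rightCross, reassoc_of% bubble_eq_zero, Limits.zero_comp,
    Limits.comp_zero, smul_zero, sub_zero, sub_add_cancel]

theorem posRightCross_comp_negLeftCross : posRightCross z C ≫ negLeftCross z C = 𝟙 _ := by
  simp only [negLeftCross, posRightCross, Preadditive.comp_sub, Preadditive.add_comp,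
    Linear.smul_comp, Linear.comp_smul, Category.assoc, rightCross_comp_leftCross,
    Category.comp_id, reassoc_of% bubble_eq_zero, Limits.zero_comp,
    Limits.comp_zero, smul_zero, add_zero, add_sub_cancel_right]

/-- By the skein relation, the correction by `z` turns the positive crossing inside `leftCross` into
the negative one. The identity term leaves a cup and a cap that are separated by naturality. In this
form the crossing can be moved around cups and caps. -/
theorem negLeftCross_eq : negLeftCross z C =
    cons down (cons up (cup z C)) ≫ cons down (neg z (down :: C)) ≫ cap z (up :: down :: C) := by
  have h : neg z (down :: C) = pos z (down :: C) - z • 𝟙 _ := by rw [← skein]; abel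
  rw [h, cons_sub, cons_smul, cons_id, Preadditive.sub_comp, Linear.smul_comp, Category.id_comp,
    Preadditive.comp_sub, Linear.comp_smul, ← cap_naturality]
  rfl

/-- The left crossing is a rotated positive crossing, and the cup undoes the rotation by the zigzag
relation. The next three lemmas are the variants with the negative crossing and with the cap. -/
theorem cup_comp_leftCross :
    cup z (up :: C) ≫ cons up (leftCross z C) = cons up (cup z C) ≫ pos z (down :: C) := by
  simp only [leftCross, cons_comp]
  rw [reassoc_of% cup_naturality, reassoc_of% cup_naturality, cup_comp_cap, Category.comp_id]

theorem cup_comp_negLeftCross :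
    cup z (up :: C) ≫ cons up (negLeftCross z C) = cons up (cup z C) ≫ neg z (down :: C) := by
  simp only [negLeftCross_eq, cons_comp]
  rw [reassoc_of% cup_naturality, reassoc_of% cup_naturality, cup_comp_cap, Category.comp_id]

theorem leftCross_comp_cap :
    leftCross z (up :: C) ≫ cons up (cap z C) = cons down (pos z C) ≫ cap z (up :: C) := by
  simp only [leftCross, Category.assoc, cap_naturality]
  rw [reassoc_of% cons_square down (pos_naturality (cap z C))]
  simp only [← reassoc_of% cons_comp, cup_comp_cap, cons_id, Category.id_comp]

theorem negLeftCross_comp_cap :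
    negLeftCross z (up :: C) ≫ cons up (cap z C) = cons down (neg z C) ≫ cap z (up :: C) := by
  simp only [negLeftCross_eq, Category.assoc, cap_naturality]
  rw [reassoc_of% cons_square down (neg_naturality (cap z C))]
  simp only [← reassoc_of% cons_comp, cup_comp_cap, cons_id, Category.id_comp]

/-- This is the braid relation with one strand turned downwards. -/
theorem leftCross_braid :
    leftCross z (up :: C) ≫ cons up (leftCross z C) ≫ pos z (down :: C) =
      cons down (pos z C) ≫ leftCross z (up :: C) ≫ cons up (leftCross z C) := by
  -- The cup created by the first left crossing is straightened against the second one. A single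
  -- cup, two positive crossings and a single cap remain, so that the braid relation applies to the
  -- upward strands.
  have h : leftCross z (up :: C) ≫ cons up (leftCross z C) =
      cons down (cons up (cons up (cup z C))) ≫ cons down (cons up (pos z (down :: C))) ≫
        cons down (pos z (up :: down :: C)) ≫ cap z (up :: up :: down :: C) := by
    rw [leftCross]
    simp only [Category.assoc, cap_naturality]
    rw [reassoc_of% cons_square down (pos_naturality (leftCross z C))]
    simp only [← reassoc_of% cons_comp, cup_comp_leftCross]
  rw [reassoc_of% h, h, cap_naturality, reassoc_of% cons_square down (pos_naturality (cup z C))]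
  simp only [← reassoc_of% cons_comp, braid]

theorem tok_comp_leftCross :
    cons down (tok z C) ≫ leftCross z C = leftCross z C ≫ tok z (down :: C) := by
  have h : tok z C ≫ cons up (cup z C) = cons up (cup z C) ≫ tok z (up :: down :: C) := by
    have h := tok_naturality (cup z C) (genAt_mem_part .leftCup C)
    rwa [show QSig.par .leftCup = 0 from rfl, superSign_comm, superSign_zero_left, one_smul] at h
  simp only [leftCross, Category.assoc, cap_naturality]
  simp only [← reassoc_of% cons_comp, ← tok_comp_pos]
  rw [reassoc_of% h]

theorem tok_comp_rightCross :
    tok z (down :: C) ≫ rightCross z C = rightCross z C ≫ cons down (tok z C) := by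
  -- Composing on both sides with the inverse of the left crossing turns sliding through it into
  -- sliding through `rightCross`.
  have h := congrArg (fun t => rightCross z C ≫ t ≫ rightCross z C) (tok_comp_leftCross z C)
  simpa [leftCross_comp_rightCross, reassoc_of% rightCross_comp_leftCross] using h.symm

theorem neg_comp_tok : neg z C ≫ tok z (up :: C) = cons up (tok z C) ≫ neg z C := by
  have h := congrArg (fun t => neg z C ≫ t ≫ neg z C) (tok_comp_pos z C)
  simpa [pos_comp_neg, reassoc_of% neg_comp_pos] using h

end

theorem negLeftCross_naturality {C C' : List Strand} (h : Mor z C C') :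
    negLeftCross z C ≫ cons up (cons down h) = cons down (cons up h) ≫ negLeftCross z C' := by
  rw [negLeftCross, negLeftCross, Preadditive.sub_comp, Preadditive.comp_sub, Linear.smul_comp,
    Linear.comp_smul, leftCross_naturality, Category.assoc, cup_naturality,
    reassoc_of% cap_naturality]

theorem posRightCross_naturality {C C' : List Strand} (h : Mor z C C') :
    posRightCross z C ≫ cons down (cons up h) = cons up (cons down h) ≫ posRightCross z C' := by
  have := congrArg (fun t => posRightCross z C ≫ t ≫ posRightCross z C') (negLeftCross_naturality h)
  simpa [negLeftCross_comp_posRightCross, reassoc_of% posRightCross_comp_negLeftCross] using this.symm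

/-! ### The action of the open Clifford token -/

/-- The action of the open Clifford token on `↑ ⊗ C`: its strand passes to the right of `C`, carries
a closed Clifford token there, and returns. -/
noncomputable def openTok (z : k) : ∀ C : List Strand, Mor z (up :: C) (up :: C)
  | [] => tok z []
  | up :: C => neg z C ≫ cons up (openTok z C) ≫ pos z C
  | down :: C => posRightCross z C ≫ cons down (openTok z C) ≫ negLeftCross z C

theorem openTok_up (C : List Strand) :
    openTok z (up :: C) = neg z C ≫ cons up (openTok z C) ≫ pos z C := rfl

theorem openTok_down (C : List Strand) :
    openTok z (down :: C) = posRightCross z C ≫ cons down (openTok z C) ≫ negLeftCross z C := rfl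

/-- All crossings are even and exactly one closed token occurs. Oddness gives the sign when a closed
token passes an open one, and it is needed to give diagrams of `AQ(z)` the right parity. -/
theorem openTok_mem_part (C : List Strand) :
    openTok z C ∈ Hom.part (QPres z) 1 (up :: C) (up :: C) := by
  have comp_mem : ∀ {X Y Z : List Strand} {i j l : ZMod 2} {f : Mor z X Y} {g : Mor z Y Z},
      f ∈ Hom.part (QPres z) i X Y → g ∈ Hom.part (QPres z) j Y Z → i + j = l →
      f ≫ g ∈ Hom.part (QPres z) l X Z := by
    rintro X Y Z i j _ f g hf hg rfl
    exact Hom.comp_mem_part (P := QPres z) hf hg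
  have hl : ∀ C, leftCross z C ∈ Hom.part (QPres z) 0 _ _ := fun C =>
    comp_mem (cons_mem_part _ (cons_mem_part _ (genAt_mem_part .leftCup C)))
      (comp_mem (cons_mem_part _ (genAt_mem_part .posUp (down :: C)))
        (genAt_mem_part .leftCap (up :: down :: C)) (add_zero _)) (add_zero _)
  have hr : ∀ C, rightCross z C ∈ Hom.part (QPres z) 0 _ _ := genAt_mem_part .negRight
  induction C with
  | nil => exact genAt_mem_part .token []
  | cons a C ih =>
    cases a with
    | up =>
      exact comp_mem (genAt_mem_part .negUp C)
        (comp_mem (cons_mem_part up ih) (genAt_mem_part .posUp C) (add_zero _)) (zero_add _)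
    | down =>
      refine comp_mem (?_ : _ ∈ Hom.part (QPres z) 0 _ _)
        (comp_mem (cons_mem_part down ih) (?_ : _ ∈ Hom.part (QPres z) 0 _ _) (add_zero _))
        (zero_add _)
      · exact add_mem (hr C) (Submodule.smul_mem _ _ (comp_mem (hr C)
          (comp_mem (genAt_mem_part .leftCap C)
            (comp_mem (genAt_mem_part .leftCup C) (hr C) (add_zero _)) (add_zero _)) (add_zero _)))
      · exact sub_mem (hl C) (Submodule.smul_mem _ _
          (comp_mem (genAt_mem_part .leftCap C) (genAt_mem_part .leftCup C) (add_zero _)))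

/-- The outgoing and the returning crossings are mutually inverse, so squaring happens at the far
right, where the closed token squares to minus the identity. -/
theorem openTok_sq (C : List Strand) : openTok z C ≫ openTok z C = -𝟙 _ := by
  induction C with
  | nil => exact tok_sq z []
  | cons a C ih =>
    have h := congrArg (cons a) ih
    rw [cons_comp, cons_neg, cons_id] at h
    cases a with
    | up =>
      simp only [openTok_up, Category.assoc, reassoc_of% pos_comp_neg, reassoc_of% h,
        Preadditive.neg_comp, Preadditive.comp_neg, Category.id_comp, neg_comp_pos]
    | down =>
      simp only [openTok_down, Category.assoc, reassoc_of% negLeftCross_comp_posRightCross,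
        reassoc_of% h, Preadditive.neg_comp, Preadditive.comp_neg, Category.id_comp,
        posRightCross_comp_negLeftCross]

/-- This is the slide relation of the open token. The clause for a leading `↑` is the only one
compatible with it, because the positive crossing is invertible. -/
theorem openTok_comp_pos (C : List Strand) :
    cons up (openTok z C) ≫ pos z C = pos z C ≫ openTok z (up :: C) := by
  rw [openTok_up, reassoc_of% pos_comp_neg]

/-- The morphism `h` of parity `j` supercommutes with the open Clifford token on its left. -/
def Commutes {X Y : List Strand} (j : ZMod 2) (h : Mor z X Y) : Prop :=
  openTok z X ≫ cons up h = superSign k 1 j • (cons up h ≫ openTok z Y)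

theorem commutes_zero_iff {X Y : List Strand} {h : Mor z X Y} :
    Commutes 0 h ↔ openTok z X ≫ cons up h = cons up h ≫ openTok z Y := by
  rw [Commutes, superSign_comm, superSign_zero_left, one_smul]

/-! ### Supernaturality of the open token action, generator by generator -/

namespace Commutes

variable {X Y Z : List Strand} {i j : ZMod 2}

theorem id (X : List Strand) : Commutes 0 (𝟙 (⟨X⟩ : Q z)) := by
  rw [commutes_zero_iff, cons_id, Category.comp_id, Category.id_comp]

theorem comp {f : Mor z X Y} {g : Mor z Y Z} (hf : Commutes i f) (hg : Commutes j g) :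
    Commutes (i + j) (f ≫ g) := by
  unfold Commutes at *
  rw [cons_comp, reassoc_of% hf, Linear.smul_comp, Category.assoc, hg, superSign_add_right,
    Linear.comp_smul, smul_smul, Category.assoc]

theorem comp_even {f : Mor z X Y} {g : Mor z Y Z} (hf : Commutes 0 f) (hg : Commutes 0 g) :
    Commutes 0 (f ≫ g) := by
  simpa using hf.comp hg

/-- The strand of the token crosses the added strand before and after meeting `f`. The crossings are
natural, so `f` passes through them and only the supercommutation over the shorter word contributes
a sign. -/
theorem cons {f : Mor z X Y} (hf : Commutes i f) (a : Strand) : Commutes i (cons a f) := by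
  unfold Commutes at *
  have h := congrArg (QuantumIsomeric.cons a) hf
  rw [cons_comp, cons_smul, cons_comp] at h
  cases a with
  | up =>
    rw [openTok_up, openTok_up, Category.assoc, Category.assoc, pos_naturality, reassoc_of% h,
      Linear.smul_comp, Linear.comp_smul, Category.assoc, reassoc_of% neg_naturality]
  | down =>
    rw [openTok_down, openTok_down, Category.assoc, Category.assoc, negLeftCross_naturality,
      reassoc_of% h, Linear.smul_comp, Linear.comp_smul, Category.assoc,
      reassoc_of% posRightCross_naturality]

/-- This disposes of the negative crossing and of the right crossing, which enter the presentation
as inverses. -/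
theorem of_inverse {f : Mor z X Y} {g : Mor z Y X} (hf : Commutes 0 f) (hfg : f ≫ g = 𝟙 _)
    (hgf : g ≫ f = 𝟙 _) : Commutes 0 g := by
  rw [commutes_zero_iff] at *
  have h := congrArg (fun t => QuantumIsomeric.cons up g ≫ t ≫ QuantumIsomeric.cons up g) hf
  have h1 : QuantumIsomeric.cons up f ≫ QuantumIsomeric.cons up g = 𝟙 _ := by
    rw [← cons_comp, hfg, cons_id]
  have h2 : QuantumIsomeric.cons up g ≫ QuantumIsomeric.cons up f = 𝟙 _ := by
    rw [← cons_comp, hgf, cons_id]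
  simp only [Category.assoc, h1, reassoc_of% h2, Category.comp_id] at h
  exact h.symm

theorem pos (C : List Strand) : Commutes 0 (pos z C) := by
  rw [commutes_zero_iff]
  have hn : QuantumIsomeric.cons up (QuantumIsomeric.neg z C) ≫
      QuantumIsomeric.cons up (QuantumIsomeric.pos z C) = 𝟙 _ := by
    rw [← cons_comp, neg_comp_pos, cons_id]
  have hp : QuantumIsomeric.cons up (QuantumIsomeric.pos z C) ≫
      QuantumIsomeric.cons up (QuantumIsomeric.neg z C) = 𝟙 _ := by
    rw [← cons_comp, pos_comp_neg, cons_id]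
  -- Multiplying the braid relation by inverse crossings on both sides gives the mixed relation by
  -- which a positive crossing passes the two outgoing negative crossings. The returning crossings
  -- use the braid relation itself.
  have h := congrArg (fun t => QuantumIsomeric.neg z (up :: C) ≫
    QuantumIsomeric.cons up (QuantumIsomeric.neg z C) ≫ t ≫
    QuantumIsomeric.neg z (up :: C) ≫ QuantumIsomeric.cons up (QuantumIsomeric.neg z C)) (braid z C)
  simp only [Category.assoc, reassoc_of% hn, reassoc_of% pos_comp_neg, reassoc_of% neg_comp_pos, hp,
    Category.comp_id] at h
  simp only [openTok_up, cons_comp, Category.assoc]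
  rw [← braid, ← reassoc_of% pos_naturality, reassoc_of% h]

theorem neg (C : List Strand) : Commutes 0 (neg z C) :=
  (pos C).of_inverse (pos_comp_neg z C) (neg_comp_pos z C)

/-- The closed token slides through both crossings. Between them it sits on a different strand from
the open token, and the super interchange of two odd morphisms gives the sign. -/
theorem tok (C : List Strand) : Commutes 1 (tok z C) := by
  have h := tok_naturality (openTok z C) (openTok_mem_part C)
  rw [superSign_one_one] at h
  rw [Commutes, superSign_one_one, openTok_up, Category.assoc, Category.assoc, ← tok_comp_pos,
    ← reassoc_of% neg_comp_tok, reassoc_of% h]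
  simp

/-- The returning strand meets the two legs of the cap in `pos` and `negLeftCross`. Pulling it over
the cap turns the latter into `neg`, which cancels `pos`. The two outgoing crossings are removed by
the same identity, and naturality of the cap moves the token past it. -/
theorem cap (C : List Strand) : Commutes 0 (cap z C) := by
  rw [commutes_zero_iff, openTok_down, openTok_up]
  simp only [cons_comp, Category.assoc, negLeftCross_comp_cap]
  have h : QuantumIsomeric.cons down (QuantumIsomeric.pos z C) ≫
      QuantumIsomeric.cons down (QuantumIsomeric.neg z C) = 𝟙 _ := by
    rw [← cons_comp, pos_comp_neg, cons_id]
  have h' := congrArg (posRightCross z (up :: C) ≫ ·) (negLeftCross_comp_cap z C)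
  simp only [reassoc_of% posRightCross_comp_negLeftCross] at h'
  rw [reassoc_of% h, ← cap_naturality, h', Category.assoc, Category.assoc]

/-- The argument for the cap applies upside down. Here the outgoing negative crossing is moved
around the cup and cancels `posRightCross`. -/
theorem cup (C : List Strand) : Commutes 0 (cup z C) := by
  rw [commutes_zero_iff, openTok_up, openTok_down]
  simp only [cons_comp, Category.assoc]
  have h1 : QuantumIsomeric.cons up (negLeftCross z C) ≫
      QuantumIsomeric.cons up (posRightCross z C) = 𝟙 _ := by
    rw [← cons_comp, negLeftCross_comp_posRightCross, cons_id]
  rw [← reassoc_of% cup_comp_negLeftCross, reassoc_of% h1, reassoc_of% cup_naturality,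
    reassoc_of% cup_comp_negLeftCross, neg_comp_pos, Category.comp_id]

theorem leftCross (C : List Strand) : Commutes 0 (leftCross z C) :=
  comp_even (((cup C).cons up).cons down)
    (comp_even ((pos (down :: C)).cons down) (cap (up :: down :: C)))

theorem rightCross (C : List Strand) : Commutes 0 (rightCross z C) :=
  (leftCross C).of_inverse (leftCross_comp_rightCross z C) (rightCross_comp_leftCross z C)

theorem genAt (g : QGen) (C : List Strand) : Commutes (QSig.par g) (genAt z g C) := by
  cases g with
  | posUp => exact pos C
  | negUp => exact neg C
  | negRight => exact rightCross C
  | leftCap => exact cap C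
  | leftCup => exact cup C
  | token => exact tok C

end Commutes

/-- The clockwise bubble on the left of `C` whose right side passes to the right of `C` and carries
a closed Clifford token there. -/
noncomputable def encircle (z : k) (C : List Strand) : Mor z C C :=
  cup z C ≫ rightCross z C ≫ cons down (openTok z C) ≫ cap z C

/-- Both correction terms, in `posRightCross` and in `negLeftCross`, contain a clockwise bubble
without token and drop out. The remaining crossings below the cap cancel. -/
theorem openTok_bubble_eq_encircle (C : List Strand) :
    cup z C ≫ openTok z (down :: C) ≫ rightCross z C ≫ cap z C = encircle z C := by
  have h1 : cup z C ≫ posRightCross z C = cup z C ≫ rightCross z C := by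
    simp only [posRightCross, Preadditive.comp_add, Linear.comp_smul, reassoc_of% bubble_eq_zero,
      Limits.zero_comp, smul_zero, add_zero]
  have h2 : negLeftCross z C ≫ rightCross z C ≫ cap z C = cap z C := by
    simp only [negLeftCross, Preadditive.sub_comp, Linear.smul_comp, Category.assoc,
      bubble_eq_zero, Limits.comp_zero, smul_zero, sub_zero, reassoc_of% leftCross_comp_rightCross]
  simp only [openTok_down, Category.assoc, h2, reassoc_of% h1, encircle]

theorem encircle_nil : encircle z [] = 0 := by
  rw [encircle, openTok, ← reassoc_of% tok_comp_rightCross, tok_bubble_eq_zero]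

/-- The right cup is `cup ≫ rightCross`, and this lets an upward strand be pulled through it. The
opposite strand of the encircling bubble is a generating cap, for which `leftCross_comp_cap` does
the same. -/
theorem rightCup_naturality (C : List Strand) :
    cup z (up :: C) ≫ rightCross z (up :: C) ≫ cons down (neg z C) ≫ leftCross z (up :: C) =
      cons up (cup z C) ≫ cons up (rightCross z C) := by
  have hn : cons down (neg z C) ≫ cons down (pos z C) = 𝟙 _ := by
    rw [← cons_comp, neg_comp_pos, cons_id]
  have hl : cons up (leftCross z C) ≫ cons up (rightCross z C) = 𝟙 _ := by
    rw [← cons_comp, leftCross_comp_rightCross, cons_id]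
  -- After cancelling inverses, the rotated braid relation rewrites the part below the cup as `cons
  -- up (leftCross z C) ≫ neg ≫ cons up rightCross`. Its first factor can be absorbed by the cup.
  have h := congrArg (fun t => rightCross z (up :: C) ≫ cons down (neg z C) ≫ t ≫
    neg z (down :: C) ≫ cons up (rightCross z C)) (leftCross_braid z C)
  simp only [Category.assoc, reassoc_of% hn, reassoc_of% pos_comp_neg,
    reassoc_of% rightCross_comp_leftCross, hl, Category.comp_id] at h
  rw [h, reassoc_of% cup_comp_leftCross, reassoc_of% pos_comp_neg]

theorem encircle_up (C : List Strand) : encircle z (up :: C) = cons up (encircle z C) := by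
  simp only [encircle, openTok_up, cons_comp, Category.assoc]
  rw [← leftCross_comp_cap, ← reassoc_of% leftCross_naturality, reassoc_of% rightCup_naturality]

/-- The encircling bubble is natural with respect to the cup, because each of its four factors is.
For the token factor this is `Commutes.cup`. -/
theorem cup_comp_encircle (C : List Strand) :
    cup z C ≫ encircle z (up :: down :: C) = encircle z C ≫ cup z C := by
  have h := cons_square down (commutes_zero_iff.1 (Commutes.cup (z := z) C))
  simp only [encircle, Category.assoc]
  rw [cap_naturality, reassoc_of% h, ← reassoc_of% cup_naturality,
    reassoc_of% rightCross_naturality]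

/-- Pulling out an upward strand leaves the bubble around the shorter word. No direct computation is
needed for a downward strand, because the bubble around `↑ ⊗ ↓ ⊗ C` composed with a cup is the
bubble around `C` followed by the cup, and the zigzag relation then frees the downward strand. -/
theorem encircle_eq_zero (C : List Strand) : encircle z C = 0 := by
  induction C with
  | nil => exact encircle_nil
  | cons a C ih =>
    cases a with
    | up => rw [encircle_up, ih, cons_zero]
    | down =>
      have h := cup_comp_encircle (z := z) C
      rw [ih, Limits.zero_comp, encircle_up] at h
      -- Adding a strand `↓` on the left and closing with a cap straightens the cup, which isolates
      -- `encircle z (down :: C)`.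
      have h' := congrArg (cons down) h
      rw [cons_comp, cons_zero] at h'
      have h'' := congrArg (· ≫ cap z (down :: C)) h'
      simpa only [Category.assoc, ← cap_naturality, reassoc_of% cons_cup_comp_cap,
        Limits.zero_comp] using h''

theorem openTok_bubble_eq_zero (C : List Strand) :
    cup z C ≫ openTok z (down :: C) ≫ rightCross z C ≫ cap z C = 0 := by
  rw [openTok_bubble_eq_encircle, encircle_eq_zero]

/-! ### The action of `AQ(z)` on `Q(z)` -/

/-- The morphism of `Q(z)` given by a single generator between identity strands. -/
noncomputable def layerMor (z : k) (A : List Strand) (g : QGen) (R : List Strand)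
    {U V : List Strand} (hU : A ++ QSig.dom g ++ R = U) (hV : A ++ QSig.cod g ++ R = V) :
    Mor z U V :=
  Cat.ofDiagram (QPres z) (.snoc .id ⟨A, g, R, hU, hV⟩)

theorem layerMor_cons (a : Strand) (A : List Strand) (g : QGen) (R : List Strand)
    {U V : List Strand} (hU : A ++ QSig.dom g ++ R = U) (hV : A ++ QSig.cod g ++ R = V) :
    layerMor z (a :: A) g R (congrArg (a :: ·) hU) (congrArg (a :: ·) hV) =
      cons a (layerMor z A g R hU hV) :=
  (cons_ofDiagram a (.snoc .id ⟨A, g, R, hU, hV⟩)).symm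

theorem ofDiagram_snoc {X Y Z : List Strand} (d : Diagram QSig X Y) (l : Layer QSig Y Z) :
    (Cat.ofDiagram (QPres z) (.snoc d l) : Mor z X Z) =
      Cat.ofDiagram (QPres z) d ≫ layerMor z l.left l.gen l.right l.dom_eq l.cod_eq :=
  ofDiagram_comp d (.snoc .id l)

/-- Transport of a morphism along equalities of words. -/
def castMor {X Y U V : List Strand} : X = U → Y = V → Mor z X Y → Mor z U V
  | rfl, rfl, f => f

theorem castMor_id {X U : List Strand} (h h' : X = U) :
    castMor h h' (𝟙 (⟨X⟩ : Q z)) = 𝟙 (⟨U⟩ : Q z) := by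
  subst h; rfl

theorem layer_word_eq {A D R B Y V : List Strand} (h : A ++ D ++ R = Y) (hV : Y ++ B = V) :
    A ++ D ++ (R ++ B) = V := by
  subst h hV; simp

/-- The open Clifford token acting between the identity of `A` and the word `R`. -/
noncomputable def openTokAt (z : k) : ∀ (A R : List Strand),
    Mor z (A ++ [up] ++ R) (A ++ [up] ++ R)
  | [], R => openTok z R
  | a :: A, R => cons a (openTokAt z A R)

/-- The action of a generator of `AQ(z)` between the identity of `A` and the word `R`. -/
noncomputable def act (z : k) (A : List Strand) : ∀ (g : AQGen) (R : List Strand)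
    {U V : List Strand}, A ++ AQSig.dom g ++ R = U → A ++ AQSig.cod g ++ R = V → Mor z U V
  | .ofQ g, R, _, _, hU, hV => layerMor z A g R hU hV
  | .openToken, R, _, _, hU, hV =>
    castMor hU hV (openTokAt z A R)

theorem act_cons (a : Strand) (A : List Strand) (g : AQGen) (R : List Strand)
    {U V : List Strand} (hU : A ++ AQSig.dom g ++ R = U) (hV : A ++ AQSig.cod g ++ R = V) :
    act z (a :: A) g R (congrArg (a :: ·) hU) (congrArg (a :: ·) hV) =
      cons a (act z A g R hU hV) := by
  cases g with
  | ofQ g => exact layerMor_cons a A g R hU hV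
  | openToken =>
    subst hU hV
    rfl

theorem act_append (B A : List Strand) (g : AQGen) (R : List Strand)
    {U V : List Strand} (hU : A ++ AQSig.dom g ++ R = U) (hV : A ++ AQSig.cod g ++ R = V)
    (hU' : (B ++ A) ++ AQSig.dom g ++ R = B ++ U) (hV' : (B ++ A) ++ AQSig.cod g ++ R = B ++ V) :
    act z (B ++ A) g R hU' hV' = whisk B (act z A g R hU hV) := by
  induction B with
  | nil => rfl
  | cons b B ih =>
    exact (act_cons b (B ++ A) g R (by simp [← hU]) (by simp [← hV])).trans
      (congrArg (cons b) (ih (by simp [← hU]) (by simp [← hV])))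

theorem act_congr (A : List Strand) (g : AQGen) {R R' : List Strand} (h : R = R')
    {U V : List Strand} (hU : A ++ AQSig.dom g ++ R = U) (hV : A ++ AQSig.cod g ++ R = V)
    (hU' : A ++ AQSig.dom g ++ R' = U) (hV' : A ++ AQSig.cod g ++ R' = V) :
    act z A g R hU hV = act z A g R' hU' hV' := by
  subst h; rfl

theorem commutes_layerMor (A : List Strand) (g : QGen) (R : List Strand)
    {U V : List Strand} (hU : A ++ QSig.dom g ++ R = U) (hV : A ++ QSig.cod g ++ R = V) :
    Commutes (QSig.par g) (layerMor z A g R hU hV) := by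
  subst hU hV
  induction A with
  | nil => exact Commutes.genAt g R
  | cons a A ih => rw [layerMor_cons a A g R rfl rfl]; exact ih.cons a

theorem commutes_ofDiagram {X Y : List Strand} (d : Diagram QSig X Y) :
    Commutes (z := z) d.parity (Cat.ofDiagram (QPres z) d : Mor z X Y) := by
  induction d with
  | id => exact Commutes.id X
  | snoc d l ih =>
    have h := ih.comp (commutes_layerMor (z := z) l.left l.gen l.right l.dom_eq l.cod_eq)
    rwa [← ofDiagram_snoc] at h

/-- This is full supernaturality of the open token action. It extends from generators to diagrams by
composition, and to homogeneous morphisms by linearity. -/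
theorem commutes_of_mem_part {X Y : List Strand} {j : ZMod 2} {f : Mor z X Y}
    (hf : f ∈ Hom.part (QPres z) j X Y) : Commutes j f := by
  unfold Commutes
  induction hf using Submodule.span_induction with
  | mem f h =>
    obtain ⟨d, rfl, rfl⟩ := h
    exact commutes_ofDiagram d
  | zero =>
    exact ((congrArg (openTok z X ≫ ·) (cons_zero up)).trans Limits.comp_zero).trans
      (((congrArg (superSign k 1 j • · ≫ openTok z Y) (cons_zero up)).trans (by simp))).symm
  | add f g _ _ hf hg =>
    refine (congrArg (openTok z X ≫ ·) (cons_add up f g)).trans (Eq.trans ?_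
      (congrArg (superSign k 1 j • · ≫ openTok z Y) (cons_add up f g)).symm)
    simp only [Preadditive.comp_add, Preadditive.add_comp, smul_add, hf, hg]
  | smul a f _ hf =>
    refine (congrArg (openTok z X ≫ ·) (cons_smul up a f)).trans (Eq.trans ?_
      (congrArg (superSign k 1 j • · ≫ openTok z Y) (cons_smul up a f)).symm)
    simp only [Linear.comp_smul, Linear.smul_comp, hf, smul_comm _ a]

/-- Each layer acts supernaturally in the word on its right. For a generator of `Q(z)` this is the
interchange law in `Q(z)`, and for the open token it is `commutes_of_mem_part`. -/
theorem act_interchange (A : List Strand) (g : AQGen) (R : List Strand) {j : ZMod 2}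
    {C C' X Y : List Strand} {h : Mor z C C'} (hh : h ∈ Hom.part (QPres z) j C C')
    (hX : A ++ AQSig.dom g ++ R = X) (hY : A ++ AQSig.cod g ++ R = Y)
    (h₁ : A ++ AQSig.dom g ++ (R ++ C) = X ++ C) (h₂ : A ++ AQSig.cod g ++ (R ++ C) = Y ++ C)
    (h₃ : A ++ AQSig.dom g ++ (R ++ C') = X ++ C')
    (h₄ : A ++ AQSig.cod g ++ (R ++ C') = Y ++ C') :
    act z A g (R ++ C) h₁ h₂ ≫ whisk Y h =
      superSign k (AQSig.par g) j • (whisk X h ≫ act z A g (R ++ C') h₃ h₄) := by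
  subst hX hY
  induction A with
  | nil =>
    have hR := whisk_mem_part R hh
    cases g with
    | ofQ g =>
      -- Fixing the generator makes its source and target concrete lists, so that `whisk` over them
      -- followed by `R` unfolds definitionally.
      cases g with
      | posUp => exact genAt_comp_whisk .posUp hR
      | negUp => exact genAt_comp_whisk .negUp hR
      | negRight => exact genAt_comp_whisk .negRight hR
      | leftCap => exact genAt_comp_whisk .leftCap hR
      | leftCup => exact genAt_comp_whisk .leftCup hR
      | token => exact genAt_comp_whisk .token hR
    | openToken => exact commutes_of_mem_part hR
  | cons a A ih =>
    have h' := congrArg (cons a) (ih (by simp) (by simp) (by simp) (by simp))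
    rw [cons_comp, cons_smul, cons_comp, ← act_cons, ← act_cons] at h'
    exact h'

/-- The action of a string diagram of `AQ(z)` on the object `B` of `Q(z)`. -/
noncomputable def diagAct (z : k) (B : List Strand) {X : List Strand} :
    ∀ {Y : List Strand}, Diagram AQSig X Y → ∀ {U V : List Strand}, X ++ B = U → Y ++ B = V →
      Mor z U V
  | _, .id, _, _, hU, hV => castMor hU hV (𝟙 _)
  | _, .snoc d l, _, _, hU, hV => diagAct z B d hU rfl ≫
      act z l.left l.gen (l.right ++ B) (layer_word_eq l.dom_eq rfl)
        (layer_word_eq l.cod_eq hV)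

/-! ### The action of diagrams and of their linear combinations -/

section diagAct

variable (B : List Strand) {X Y Z U V W : List Strand}

theorem diagAct_snoc (d : Diagram AQSig X Y) (l : Layer AQSig Y Z) (hU : X ++ B = U)
    (hW : Y ++ B = W) (hV : Z ++ B = V) (h₁ : l.left ++ AQSig.dom l.gen ++ (l.right ++ B) = W)
    (h₂ : l.left ++ AQSig.cod l.gen ++ (l.right ++ B) = V) :
    diagAct z B (d.snoc l) hU hV = diagAct z B d hU hW ≫ act z l.left l.gen (l.right ++ B) h₁ h₂ := by
  subst hW; rfl

theorem diagAct_comp (d : Diagram AQSig X Y) (e : Diagram AQSig Y Z) (hU : X ++ B = U)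
    (hW : Y ++ B = W) (hV : Z ++ B = V) :
    diagAct z B (d.comp e) hU hV = diagAct z B d hU hW ≫ diagAct z B e hW hV := by
  induction e generalizing V with
  | id => subst hW hV; exact (Category.comp_id _).symm
  | snoc e l ih =>
    rw [Diagram.comp, diagAct, diagAct, ih rfl, Category.assoc]

/-- Identity strands on the right are absorbed into the word acted upon. The freely chosen endpoints
`U` and `V` in `diagAct` take care of the associativity of concatenation. -/
theorem diagAct_whiskerR (D : List Strand) (d : Diagram AQSig X Y) (hU : (X ++ D) ++ B = U)
    (hV : (Y ++ D) ++ B = V) (hU' : X ++ (D ++ B) = U) (hV' : Y ++ (D ++ B) = V) :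
    diagAct z B (d.whiskerR D) hU hV = diagAct z (D ++ B) d hU' hV' := by
  induction d generalizing V with
  | id =>
    obtain rfl : U = V := hU.symm.trans hV
    exact (castMor_id _ _).trans (castMor_id _ _).symm
  | snoc d l ih =>
    rw [Diagram.whiskerR, diagAct, ih rfl (List.append_assoc _ _ _).symm,
      diagAct_snoc (D ++ B) d l hU' (List.append_assoc _ _ _).symm hV'
        (layer_word_eq l.dom_eq (List.append_assoc _ _ _).symm) (layer_word_eq l.cod_eq hV')]
    exact congrArg _ (act_congr _ _ (by simp [Layer.whiskerR]) _ _ _ _)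

theorem diagAct_whiskerL (A : List Strand) (d : Diagram AQSig X Y) (hU : X ++ B = U)
    (hV : Y ++ B = V) (hU' : (A ++ X) ++ B = A ++ U) (hV' : (A ++ Y) ++ B = A ++ V) :
    diagAct z B (d.whiskerL A) hU' hV' = whisk A (diagAct z B d hU hV) := by
  induction d generalizing V with
  | id =>
    subst hU hV
    rw [whisk_eq]
    exact (castMor_id _ _).trans (Cat.whiskerL_id (P := QPres z) ⟨A⟩ ⟨X ++ B⟩).symm
  | snoc d l ih =>
    rw [diagAct, whisk_comp, ← ih rfl (List.append_assoc _ _ _), Diagram.whiskerL,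
      diagAct_snoc B _ (l.whiskerL A) hU' (List.append_assoc _ _ _) hV'
        (layer_word_eq (l.whiskerL A).dom_eq (List.append_assoc _ _ _))
        (layer_word_eq (l.whiskerL A).cod_eq hV')]
    exact congrArg _ (act_append _ _ _ _ _ _ _ _)

theorem act_mem_part (A : List Strand) (g : AQGen) (R : List Strand)
    (hU : A ++ AQSig.dom g ++ R = U) (hV : A ++ AQSig.cod g ++ R = V) :
    act z A g R hU hV ∈ Hom.part (QPres z) (AQSig.par g) U V := by
  subst hU hV
  induction A with
  | nil =>
    cases g with
    | ofQ g => exact genAt_mem_part g R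
    | openToken => exact openTok_mem_part R
  | cons a A ih => rw [act_cons a A g R rfl rfl]; exact cons_mem_part a ih

theorem diagAct_mem_part (d : Diagram AQSig X Y) (hU : X ++ B = U) (hV : Y ++ B = V) :
    diagAct z B d hU hV ∈ Hom.part (QPres z) d.parity U V := by
  induction d generalizing V with
  | id => subst hU hV; exact Hom.of_mem_part (P := QPres z) Diagram.id
  | snoc d l ih => exact Hom.comp_mem_part (P := QPres z) (ih rfl) (act_mem_part _ _ _ _ _)

/-- Every diagram of `AQ(z)` acts by a supernatural transformation. This is what turns the super
interchange law of `AQ(z)` into an identity in `Q(z)`. -/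
theorem diagAct_interchange (d : Diagram AQSig X Y) {j : ZMod 2} {C C' : List Strand}
    {h : Mor z C C'} (hh : h ∈ Hom.part (QPres z) j C C') :
    whisk X h ≫ diagAct z C' d rfl rfl =
      superSign k d.parity j • (diagAct z C d rfl rfl ≫ whisk Y h) := by
  induction d with
  | id =>
    rw [Diagram.parity, superSign_zero_left, one_smul]
    exact (Category.comp_id _).trans (Category.id_comp _).symm
  | snoc d l ih =>
    -- The sign of the last layer appears twice and squares to one, because `act_interchange` moves
    -- `h` in the opposite direction.
    rw [diagAct, diagAct, reassoc_of% ih, Category.assoc, act_interchange _ _ _ hh l.dom_eq l.cod_eq,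
      Linear.comp_smul, Diagram.parity, superSign_add_left, smul_smul, Linear.smul_comp,
      mul_assoc, superSign_mul_self, mul_one, Category.assoc]

/-- Evaluation at the empty word recovers the diagram. This is the left inverse behind faithfulness.
-/
theorem diagAct_map (d : Diagram QSig X Y) (hU : X ++ [] = X) (hV : Y ++ [] = Y) :
    diagAct z [] (d.map inclGen) hU hV = Cat.ofDiagram (QPres z) d := by
  induction d with
  | id => exact castMor_id _ _
  | @snoc Y Z d l ih =>
    rw [Diagram.map, diagAct_snoc [] _ (l.map inclGen) hU (List.append_nil Y) hV
      (layer_word_eq (l.map inclGen).dom_eq (List.append_nil Y))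
      (layer_word_eq (l.map inclGen).cod_eq hV), ih,
      act_congr _ _ (List.append_nil _) _ _ (l.map inclGen).dom_eq (l.map inclGen).cod_eq]
    exact (ofDiagram_snoc d l).symm

theorem diagAct_map_whiskerR (d : Diagram QSig X Y) :
    diagAct z B (d.map inclGen) rfl rfl = Cat.ofDiagram (QPres z) (d.whiskerR B) := by
  induction d with
  | id => rfl
  | snoc d l ih =>
    rw [Diagram.map, diagAct, ih]
    exact (ofDiagram_snoc (d.whiskerR B) (l.whiskerR B)).symm

/-- The action of a linear combination of string diagrams of `AQ(z)` on the object `B`. -/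
noncomputable def chainAct (z : k) (B : List Strand) (hU : X ++ B = U) (hV : Y ++ B = V) :
    Chain k AQSig X Y →ₗ[k] Mor z U V :=
  Finsupp.linearCombination k fun d => diagAct z B d hU hV

variable (hU : X ++ B = U) (hV : Y ++ B = V)

@[simp] theorem chainAct_of (d : Diagram AQSig X Y) :
    chainAct z B hU hV (Chain.of k d) = diagAct z B d hU hV := by
  simp [chainAct, Chain.of]

theorem chainAct_of_comp (hW : Y ++ B = W) (hV : Z ++ B = V) (d : Diagram AQSig X Y)
    (f : Chain k AQSig Y Z) :
    chainAct z B hU hV (Chain.comp (Chain.of k d) f) =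
      diagAct z B d hU hW ≫ chainAct z B hW hV f := by
  induction f using Chain.induction with
  | hz => simp
  | ha f g hf hg => simp only [map_add, hf, hg, Preadditive.comp_add]
  | hs a f hf => simp only [map_smul, hf, Linear.comp_smul]
  | ho e => rw [Chain.comp_of, chainAct_of, chainAct_of, diagAct_comp]

theorem chainAct_comp_of (hW : Y ++ B = W) (hV : Z ++ B = V) (f : Chain k AQSig X Y)
    (e : Diagram AQSig Y Z) :
    chainAct z B hU hV (Chain.comp f (Chain.of k e)) =
      chainAct z B hU hW f ≫ diagAct z B e hW hV := by
  induction f using Chain.induction with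
  | hz => simp
  | ha f g hf hg => simp only [map_add, LinearMap.add_apply, hf, hg, Preadditive.add_comp]
  | hs a f hf => simp only [map_smul, LinearMap.smul_apply, hf, Linear.smul_comp]
  | ho e => rw [Chain.comp_of, chainAct_of, chainAct_of, diagAct_comp]

theorem chainAct_whiskerR (D : List Strand) (f : Chain k AQSig X Y) (hU : (X ++ D) ++ B = U)
    (hV : (Y ++ D) ++ B = V) (hU' : X ++ (D ++ B) = U) (hV' : Y ++ (D ++ B) = V) :
    chainAct z B hU hV (Chain.whiskerR D f) = chainAct z (D ++ B) hU' hV' f := by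
  induction f using Chain.induction with
  | hz => simp
  | ha f g hf hg => simp only [map_add, hf, hg]
  | hs a f hf => simp only [map_smul, hf]
  | ho d => rw [Chain.whiskerR_of, chainAct_of, chainAct_of, diagAct_whiskerR]

theorem chainAct_whiskerL (A : List Strand) (f : Chain k AQSig X Y)
    (hU' : (A ++ X) ++ B = A ++ U) (hV' : (A ++ Y) ++ B = A ++ V) :
    chainAct z B hU' hV' (Chain.whiskerL A f) = whisk A (chainAct z B hU hV f) := by
  rw [whisk_eq]
  induction f using Chain.induction with
  | hz =>
    rw [map_zero, map_zero, map_zero]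
    exact (map_zero (Hom.whiskerL (P := QPres z) A)).symm
  | ha f g hf hg => simp only [map_add, hf, hg, Cat.whiskerL_add]
  | hs a f hf => simp only [map_smul, hf, Cat.whiskerL_smul]
  | ho d => rw [Chain.whiskerL_of, chainAct_of, chainAct_of, diagAct_whiskerL, whisk_eq]

theorem chainAct_map (f : Chain k QSig X Y) (hU : X ++ [] = X) (hV : Y ++ [] = Y) :
    chainAct z [] hU hV (Chain.map inclGen f) = Hom.mk (QPres z) f := by
  induction f using Chain.induction with
  | hz => rw [map_zero, map_zero]; rfl
  | ha f g hf hg =>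
    rw [map_add, map_add, hf, hg]; exact (map_add (Hom.mk (QPres z)) f g).symm
  | hs a f hf => rw [map_smul, map_smul, hf]; exact (map_smul (Hom.mk (QPres z)) a f).symm
  | ho d => rw [Chain.map_of, chainAct_of, diagAct_map]; rfl

theorem chainAct_map_eq_toMor (f : Chain k QSig X Y) :
    chainAct z B rfl rfl (Chain.map inclGen f) = toMor B f := by
  induction f using Chain.induction with
  | hz => simp
  | ha f g hf hg => simp only [map_add, hf, hg]
  | hs a f hf => simp only [map_smul, hf]
  | ho d => rw [Chain.map_of, chainAct_of, diagAct_map_whiskerR, toMor_of]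

end diagAct

/-! ### The action factors through the relations of `AQ(z)` -/

theorem chainAct_rel {X Y : List Strand} {f : Chain k AQSig X Y} (hf : AQRel z X Y f)
    (B : List Strand) : chainAct z B rfl rfl f = (0 : Mor z _ _) := by
  -- A diagram with a single layer acts by an identity followed by that layer.
  have ht : diagAct z B openToken rfl rfl = openTok z B := by
    exact Category.id_comp _
  cases hf with
  | ofQ hf => rw [chainAct_map_eq_toMor, toMor_eq_zero hf]
  | openToken_sq =>
    rw [map_sub, map_neg, chainAct_of, chainAct_of, diagAct_comp B _ _ rfl rfl rfl, ht, openTok_sq]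
    exact sub_self _
  | openToken_slide =>
    have h1 : diagAct z B openToken₁ rfl rfl = openTok z (up :: B) := by
      exact Category.id_comp _
    have h2 : diagAct z B openToken₂ rfl rfl = cons up (openTok z B) := by
      exact Category.id_comp _
    rw [map_sub, chainAct_of, chainAct_of, diagAct_comp B _ _ rfl rfl rfl,
      diagAct_comp B _ _ rfl rfl rfl, h1, h2, diagAct_map_whiskerR, sub_eq_zero]
    exact openTok_comp_pos B
  | openToken_bubble =>
    have h1 : diagAct z B (openToken.whiskerR [down]) rfl rfl = openTok z (down :: B) := by
      exact Category.id_comp _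
    rw [sub_zero, chainAct_of, openTokenBubble, diagAct_comp B _ _ rfl rfl rfl,
      diagAct_comp B _ _ rfl rfl rfl, h1, diagAct_map_whiskerR, diagAct_map_whiskerR,
      ofDiagram_rightCap]
    exact openTok_bubble_eq_zero B

/-- The diagram `g` acts by a morphism of `Q(z)` of the same parity, and the claim is the
supernaturality of the action of `f` with respect to that morphism. -/
theorem chainAct_interchange {X X' Y Y' : List Strand} (f : Diagram AQSig X X')
    (g : Diagram AQSig Y Y') (B : List Strand) {U V : List Strand} (hU : (X ++ Y) ++ B = U)
    (hV : (X' ++ Y') ++ B = V) :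
    chainAct z B hU hV (Chain.of k ((g.whiskerL X).comp (f.whiskerR Y')) -
      superSign k f.parity g.parity • Chain.of k ((f.whiskerR Y).comp (g.whiskerL X'))) = 0 := by
  obtain rfl : X ++ (Y ++ B) = U := by rw [← hU, List.append_assoc]
  obtain rfl : X' ++ (Y' ++ B) = V := by rw [← hV, List.append_assoc]
  rw [map_sub, map_smul, chainAct_of, chainAct_of,
    diagAct_comp B _ _ hU (List.append_assoc X Y' B) hV,
    diagAct_comp B _ _ hU (List.append_assoc X' Y B) hV,
    diagAct_whiskerL B X g rfl rfl, diagAct_whiskerL B X' g rfl rfl,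
    diagAct_whiskerR B Y' f _ _ rfl rfl, diagAct_whiskerR B Y f _ _ rfl rfl,
    diagAct_interchange f (diagAct_mem_part B g rfl rfl), sub_self]

/-- The vanishing is proved at all words `B` simultaneously, because tensoring with `D` on the right
replaces `B` by `D ++ B` in the induction. -/
theorem chainAct_ideal {X Y : List Strand} {f : Chain k (AQPres z).sig X Y}
    (hf : (AQPres z).Ideal X Y f) (B : List Strand) {U V : List Strand} (hU : X ++ B = U)
    (hV : Y ++ B = V) : chainAct z B hU hV f = 0 := by
  induction hf generalizing B U V with
  | rel hf => subst hU hV; exact chainAct_rel hf B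
  | interchange f g => exact chainAct_interchange f g B hU hV
  | zero => exact map_zero _
  | add _ _ hf hg =>
    exact (map_add (chainAct z B hU hV) _ _).trans (by rw [hf, hg, add_zero])
  | smul a _ hf => exact (map_smul (chainAct z B hU hV) a _).trans (by rw [hf, smul_zero])
  | comp_left d _ hf => exact (chainAct_of_comp B hU rfl hV d _).trans (by rw [hf, Limits.comp_zero])
  | comp_right _ e hf => exact (chainAct_comp_of B hU rfl hV _ e).trans (by rw [hf, Limits.zero_comp])
  | @whiskerL A X Y f _ hf =>
    obtain rfl : A ++ (X ++ B) = U := by rw [← hU, List.append_assoc]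
    obtain rfl : A ++ (Y ++ B) = V := by rw [← hV, List.append_assoc]
    exact (chainAct_whiskerL B rfl rfl A f hU hV).trans
      ((congrArg (whisk A) (hf B rfl rfl)).trans (whisk_zero A))
  | whiskerR _ D hf =>
    exact (chainAct_whiskerR B D _ hU hV (by simpa using hU) (by simpa using hV)).trans (hf _ _ _)

/-! ### Faithfulness, by evaluating at the unit object -/

theorem mapHom_injective (X Y : List Strand) :
    Function.Injective ((inclPres z).mapHom : (QPres z).Hom X Y → (AQPres z).Hom X Y) := by
  rw [← LinearMap.ker_eq_bot, LinearMap.ker_eq_bot']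
  intro f hf
  obtain ⟨f, rfl⟩ := Hom.mk_surjective f
  rw [PresentationHom.mapHom_mk, Hom.mk_eq_zero] at hf
  exact (chainAct_map f (List.append_nil X) (List.append_nil Y)).symm.trans
    (chainAct_ideal hf [] _ _)

end QuantumIsomeric

theorem mainTheorem8 (k : Type u) [CommRing k] (hk : ringChar k ≠ 2) (z : k) :
    (∀ X : QuantumIsomeric.Q z, ((QuantumIsomeric.natural z).obj X).word = X.word) ∧
    (∀ g : QuantumIsomeric.QGen,
      (QuantumIsomeric.natural z).map (QuantumIsomeric.Q.gen z g) = QuantumIsomeric.AQ.gen z g) ∧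
    (QuantumIsomeric.natural z).toFunctor.Faithful := by
  refine ⟨fun _ => rfl, fun g => ?_, ⟨fun h => QuantumIsomeric.mapHom_injective _ _ h⟩⟩
  exact (QuantumIsomeric.inclPres z).mapHom_of _
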